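/- All graphs are finite acyclic directed graphs. For vertices $a,b$ of such a graph $G$ write $a\ge b$ ($G$-order) if there is a directed path (possibly of length $0$) from $a$ to $b$. A linear extension $\ell$ of $G$-order lists the vertices so that $b$ precedes $a$ whenever $a>b$; a reverse linear extension $\ell'$ lists them in the opposite sense. **Tight orthogonal pairs.** An orthogonal pair of independent sets is a pair $(\mathcal D,\mathcal U)$ of disjoint sets of vertices, each consisting of pairwise non-adjacent vertices, with no edge from an element of $\mathcal D$ to an element of $\mathcal U$. It is tight if the result is never again an orthogonal pair of independent sets when one puts a vertex $k\notin\mathcal D$ into $\mathcal D$ and removes from $\mathcal D$ some (possibly empty) set of elements all of which are smaller than $k$, or when one puts a vertex $k\notin\mathcal U$ into $\mathcal U$ and removes from $\mathcal U$ some (possibly empty) set of elements all of which are larger than $k$. Let $\mathrm{top}(G)$ be the set of tight orthogonal pairs. **Flips and the independence poset.** The flip of $(\mathcal D,\mathcal U)\in\mathrm{top}(G)$ at a vertex $g$ does nothing if $g\notin\mathcal D\cup\mathcal U$. Otherwise, keep the elements of $\mathcal D$ that are not $\le g$ and the elements of $\mathcal U$ that are not $\ge g$; put $g$ into the second set if it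 was in $\mathcal D$, and into the first set if it was in $\mathcal U$. Then go through the vertices $k\not\ge g$ in the order $\ell'$, adding $k$ to the first set whenever the result is an orthogonal pair of independent sets, and afterwards go through the vertices $k\not\le g$ in the order $\ell$, adding $k$ to the second set whenever the result is an orthogonal pair of independent sets. The set $\mathrm{top}(G)$ is partially ordered by the reflexive and transitive closure of the relations $(\mathcal D,\mathcal U)<(\mathcal D',\mathcal U')$, where $(\mathcal D',\mathcal U')$ is the flip of $(\mathcal D,\mathcal U)$ at some $g\in\mathcal U$. **Maximal orthogonal pairs.** $\mathcal L(G)$ is the set of pairs $(X,Y)$ of disjoint sets of vertices with no edge from an element of $X$ to an element of $Y$, such that neither $X$ nor $Y$ can be enlarged with this property preserved, ordered by inclusion of $X$. **Trim lattices.** A finite lattice is extremal if the largest length $r$ of a chain $x_0<\dots<x_r$ equals both the number of join irreducible elements and the number of meet irreducible elements. An element $x$ is left modular if $(y\vee x)\wedge z=y\vee(x\wedge z)$ for all $y\le z$. A trim lattice is an extremal finite lattice that has a maximal chain of left modular elements. **Theorem.** 1. Let $G$ and $H$ be finite acyclic directed graphs. If $\mathrm{top}(G)\simeq\mathcal L(H)$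 as posets, then $G\simeq H$ as directed graphs. 2. Let $G$ be a finite acyclic directed graph. If $\mathrm{top}(G)$ is a lattice, then $\mathrm{top}(G)\simeq\mathcal L(G)$ as posets. 3. For every trim lattice $L$ there is a finite acyclic directed graph $G$ with $L\simeq\mathrm{top}(G)$ as posets, and $G$ is unique up to isomorphism of directed graphs. -/

import Mathlib

universe u v w

/-- An acyclic directed graph on the vertex set `V`: no directed cycle, in particular no loop. -/
structure AcyclicDigraph (V : Type*) extends Digraph V where
  acyclic : ∀ v, ¬ Relation.TransGen toDigraph.Adj v v

namespace AcyclicDigraph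

variable {V : Type u} (G : AcyclicDigraph V)

/-- `G.Geq a b`: `a ≥ b` in `G`-order, i.e. there is a directed path (possibly of length zero)
from `a` to `b`. -/
def Geq (a b : V) : Prop := Relation.ReflTransGen G.Adj a b

/-- `G.Gtr a b`: `a > b` in `G`-order. -/
def Gtr (a b : V) : Prop := G.Geq a b ∧ a ≠ b

/-- Isomorphism of directed graphs. -/
def IsIsoTo {W : Type*} (H : AcyclicDigraph W) : Prop := Nonempty (G.Adj ≃r H.Adj)

/-! ### Tight orthogonal pairs -/

/-- A set of pairwise non-adjacent vertices. -/
def IsIndep (A : Set V) : Prop := ∀ a ∈ A, ∀ b ∈ A, ¬ G.Adj a b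

/-- An orthogonal pair of (disjoint) independent sets: no edge goes from `D` to `U`. -/
def IsOrthIndep (D U : Set V) : Prop :=
  G.IsIndep D ∧ G.IsIndep U ∧ Disjoint D U ∧ ∀ d ∈ D, ∀ u ∈ U, ¬ G.Adj d u

/-- Tightness: the pair stops being an orthogonal pair of independent sets whenever a new element
`k` is put into `D` while a set `S` of elements of `D` that are smaller than `k` is removed, or a
new element `k` is put into `U` while a set `S` of elements of `U` that are larger than `k` is
removed. Here `S = ∅` is the addition of a new element, `S = {d}` the replacement of `d` by a
larger (in `U`: smaller) element, and a larger `S` the simultaneous replacement of several elements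
by a common larger (smaller) one. -/
def IsTight (D U : Set V) : Prop :=
  (∀ k ∉ D, ∀ S ⊆ D, (∀ s ∈ S, G.Gtr k s) → ¬ G.IsOrthIndep (insert k (D \ S)) U) ∧
  (∀ k ∉ U, ∀ S ⊆ U, (∀ s ∈ S, G.Gtr s k) → ¬ G.IsOrthIndep D (insert k (U \ S)))

/-- The set `top(G)` of tight orthogonal pairs of independent sets. -/
@[ext] structure Tops where
  D : Set V
  U : Set V
  orth : G.IsOrthIndep D U
  tight : G.IsTight D U

/-! ### Flips -/

/-- `ℓ` lists all the vertices so that no later vertex is below or equal to an earlier one. -/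
def IsLinearExtension (ℓ : List V) : Prop :=
  (∀ v, v ∈ ℓ) ∧ ℓ.Pairwise (fun a b => ¬ G.Geq a b)

/-- `ℓ` lists all the vertices so that no later vertex is above or equal to an earlier one. -/
def IsReverseLinearExtension (ℓ : List V) : Prop :=
  (∀ v, v ∈ ℓ) ∧ ℓ.Pairwise (fun a b => ¬ G.Geq b a)

/-- Go through a list, adding each element that the current set `A` allows. -/
def greedy (ok : V → Set V → Prop) : List V → Set V → Set V
  | [], A => A
  | k :: l, A => greedy ok l (A ∪ {x | x = k ∧ ok k A})

/-- The second half of a flip at `g`: from the pair `(D₀, U₀)` of preserved elements (and `g`),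
complete first `D₀` greedily in the order `ℓ'` with elements that are not above `g`, and then `U₀`
greedily in the order `ℓ` with elements that are not below `g`, each time adding an element if the
result is still an orthogonal pair of independent sets. -/
def complete (ℓ ℓ' : List V) (g : V) (D₀ U₀ : Set V) : Set V × Set V :=
  let D₁ := greedy (fun k D => ¬ G.Geq k g ∧ G.IsOrthIndep (insert k D) U₀) ℓ' D₀
  let U₁ := greedy (fun k U => ¬ G.Geq g k ∧ G.IsOrthIndep D₁ (insert k U)) ℓ U₀
  (D₁, U₁)

open Classical in
/-- The flip of `(D, U)` at `g`, computed with the linear extension `ℓ` and the reverse linear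
extension `ℓ'`: keep the elements of `D` not below `g` and the elements of `U` not above `g`, switch
the set to which `g` belongs, and complete greedily. -/
noncomputable def flip (ℓ ℓ' : List V) (g : V) (D U : Set V) : Set V × Set V :=
  if g ∈ U then
    G.complete ℓ ℓ' g (insert g {k | k ∈ D ∧ ¬ G.Geq g k}) {k | k ∈ U ∧ ¬ G.Geq k g}
  else if g ∈ D then
    G.complete ℓ ℓ' g {k | k ∈ D ∧ ¬ G.Geq g k} (insert g {k | k ∈ U ∧ ¬ G.Geq k g})
  else (D, U)

/-! ### The independence poset -/

variable {G}

/-- `t'` is obtained from `t` by flipping at an element of `U`. (On `top(G)` the result of a flip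
does not depend on `ℓ` and `ℓ'`.) -/
def Tops.FlipUp (t t' : G.Tops) : Prop :=
  ∃ ℓ ℓ' : List V, G.IsLinearExtension ℓ ∧ G.IsReverseLinearExtension ℓ' ∧
    ∃ g ∈ t.U, G.flip ℓ ℓ' g t.D t.U = (t'.D, t'.U)

/-! The facts from here to `Tops.flipUp_antisymm` show that flips upward generate no cycle. -/

theorem subset_greedy (ok : V → Set V → Prop) (l : List V) (A : Set V) :
    A ⊆ greedy ok l A := by
  induction l generalizing A with
  | nil => exact subset_rfl
  | cons k l ih => exact Set.subset_union_left.trans (ih _)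

theorem of_mem_greedy {ok : V → Set V → Prop} {l : List V} {A : Set V} {x : V}
    (hx : x ∈ greedy ok l A) : x ∈ A ∨ ∃ B, A ⊆ B ∧ ok x B := by
  induction l generalizing A with
  | nil => exact Or.inl hx
  | cons k l ih =>
    rcases ih hx with (h | ⟨rfl, h⟩) | ⟨B, hB, h⟩
    · exact Or.inl h
    · exact Or.inr ⟨A, subset_rfl, h⟩
    · exact Or.inr ⟨B, Set.subset_union_left.trans hB, h⟩

theorem Geq.antisymm {a b : V} (hab : G.Geq a b) (hba : G.Geq b a) : a = b := by
  rcases Relation.reflTransGen_iff_eq_or_transGen.1 hab with h | h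
  · exact h.symm
  · exact absurd (h.trans_left hba) (G.acyclic a)

theorem Tops.flipUp_spec {t t' : G.Tops} (h : t.FlipUp t') :
    ∃ g, g ∈ t'.D ∧ g ∉ t.D ∧ ∀ k, ¬ G.Geq g k → (k ∈ t'.D ↔ k ∈ t.D) := by
  obtain ⟨ℓ, ℓ', -, -, g, hg, h⟩ := h
  rw [flip, if_pos hg] at h
  have hD : greedy (fun k D => ¬ G.Geq k g ∧
      G.IsOrthIndep (insert k D) {k | k ∈ t.U ∧ ¬ G.Geq k g}) ℓ'
      (insert g {k | k ∈ t.D ∧ ¬ G.Geq g k}) = t'.D := congrArg Prod.fst h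
  have hgD : g ∉ t.D := fun h' => Set.disjoint_left.1 t.orth.2.2.1 h' hg
  refine ⟨g, hD ▸ subset_greedy _ _ _ (Set.mem_insert _ _), hgD, fun k hk => ⟨fun hkD => ?_,
    fun hkD => hD ▸ subset_greedy _ _ _ (Set.mem_insert_of_mem _ ⟨hkD, hk⟩)⟩⟩
  rw [← hD] at hkD
  rcases of_mem_greedy hkD with (rfl | h') | ⟨B, hB, hkg, hi, -, hdisj, hno⟩
  · exact absurd Relation.ReflTransGen.refl hk
  · exact h'.1
  · by_contra hkD'
    refine t.tight.1 k hkD' {s | s ∈ t.D ∧ G.Gtr k s} (fun s hs => hs.1) (fun s hs => hs.2) ?_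
    have hdk : ∀ d ∈ t.D, ¬ G.Adj d k := fun d hd hdk => by
      have : ¬ G.Geq g d := fun h' => hk (h'.tail hdk)
      exact hi d (Set.mem_insert_of_mem _ (hB (Set.mem_insert_of_mem _ ⟨hd, this⟩))) k
        (Set.mem_insert _ _) hdk
    have hkk : ¬ G.Adj k k := fun h' => G.acyclic k (.single h')
    refine ⟨?_, t.orth.2.1, ?_, ?_⟩
    · rintro a (rfl | ⟨ha, ha'⟩) b (rfl | ⟨hb, hb'⟩)
      · exact hkk
      · exact fun h' => hb' ⟨hb, .single h', fun e => hkD' (e ▸ hb)⟩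
      · exact hdk a ha
      · exact t.orth.1 a ha b hb
    · rw [Set.disjoint_left]
      rintro a (rfl | ⟨ha, -⟩) haU
      · exact Set.disjoint_left.1 hdisj (Set.mem_insert _ _) ⟨haU, hkg⟩
      · exact Set.disjoint_left.1 t.orth.2.2.1 ha haU
    · rintro a (rfl | ⟨ha, -⟩) u hu
      · exact fun h' => hno a (Set.mem_insert _ _) u
          ⟨hu, fun h'' => hkg (Relation.ReflTransGen.head h' h'')⟩ h'
      · exact t.orth.2.2.2 a ha u hu

theorem Tops.flipUp_antisymm {t t' : G.Tops} (h : Relation.ReflTransGen Tops.FlipUp t t')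
    (h' : Relation.ReflTransGen Tops.FlipUp t' t) : t = t' := by
  have hpo : IsPartialOrder V (fun a b => G.Geq b a) :=
    { refl := fun a => Relation.ReflTransGen.refl
      trans := fun a b c hab hbc => Relation.ReflTransGen.trans hbc hab
      antisymm := fun a b hab hba => Geq.antisymm hba hab }
  obtain ⟨s, hs, hle⟩ := extend_partialOrder (fun a b : V => G.Geq b a)
  -- `R t t'`: the largest change from `t.D` to `t'.D` is that an element is added
  let R : G.Tops → G.Tops → Prop := fun t t' =>
    ∃ g, g ∈ t'.D ∧ g ∉ t.D ∧ ∀ k, ¬ s k g → (k ∈ t'.D ↔ k ∈ t.D)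
  have key : ∀ {t t' : G.Tops}, Relation.TransGen Tops.FlipUp t t' → R t t' := by
    intro t t' h
    have step : ∀ {t t' : G.Tops}, Tops.FlipUp t t' → R t t' := fun h => by
      obtain ⟨g, h1, h2, h3⟩ := Tops.flipUp_spec h
      exact ⟨g, h1, h2, fun k hk => h3 k fun h => hk (hle _ _ h)⟩
    induction h with
    | single h => exact step h
    | tail _ h ih =>
      obtain ⟨g, h1, h2, h3⟩ := ih
      obtain ⟨g', h1', h2', h3'⟩ := step h
      by_cases hgg : s g g'
      · have hne : ¬ s g' g := fun h'' => by
          have : g = g' := antisymm_of s hgg h''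
          subst this
          exact h2' h1
        exact ⟨g', h1', fun hn => h2' ((h3 g' hne).2 hn), fun k hk =>
          (h3' k hk).trans (h3 k fun hkg => hk (trans_of s hkg hgg))⟩
      · have hgg' : s g' g := (total_of s g g').resolve_left hgg
        exact ⟨g, (h3' g hgg).2 h1, h2, fun k hk =>
          (h3' k fun hkg => hk (trans_of s hkg hgg')).trans (h3 k hk)⟩
  rcases Relation.reflTransGen_iff_eq_or_transGen.1 h with h | h
  · exact h.symm
  · obtain ⟨g, h1, h2, -⟩ := key (h.trans_left h')
    exact absurd h1 h2

/-- The independence poset: the reflexive and transitive closure of the flips upward. -/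
instance : PartialOrder G.Tops where
  le := Relation.ReflTransGen Tops.FlipUp
  le_refl _ := Relation.ReflTransGen.refl
  le_trans _ _ _ := Relation.ReflTransGen.trans
  le_antisymm _ _ := Tops.flipUp_antisymm

variable (G)

/-! ### Maximal orthogonal pairs -/

/-- Disjoint sets of vertices without an edge from the first to the second. -/
def IsOrth (X Y : Set V) : Prop := Disjoint X Y ∧ ∀ x ∈ X, ∀ y ∈ Y, ¬ G.Adj x y

/-- The set `L(G)` of maximal orthogonal pairs. -/
@[ext] structure Mops where
  X : Set V
  Y : Set V
  orth : G.IsOrth X Y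
  max_left : ∀ X', X ⊆ X' → G.IsOrth X' Y → X' = X
  max_right : ∀ Y', Y ⊆ Y' → G.IsOrth X Y' → Y' = Y

variable {G}

theorem Mops.Y_subset_of_X_subset {p q : G.Mops} (h : p.X ⊆ q.X) : q.Y ⊆ p.Y := by
  have : G.IsOrth p.X (p.Y ∪ q.Y) := by
    refine ⟨Set.disjoint_union_right.2 ⟨p.orth.1, q.orth.1.mono_left h⟩, ?_⟩
    rintro x hx y (hy | hy)
    · exact p.orth.2 x hx y hy
    · exact q.orth.2 x (h hx) y hy
  rw [← p.max_right _ Set.subset_union_left this]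
  exact Set.subset_union_right

/-- `L(G)` is ordered by inclusion of first components. -/
instance : PartialOrder G.Mops where
  le p q := p.X ⊆ q.X
  le_refl _ := subset_rfl
  le_trans _ _ _ := Set.Subset.trans
  le_antisymm p q h h' := Mops.ext (h.antisymm h')
    ((Mops.Y_subset_of_X_subset h').antisymm (Mops.Y_subset_of_X_subset h))

end AcyclicDigraph

/-! ### Lattices -/

/-- A partial order in which any two elements have a join and a meet. -/
def IsLatticeOrder (α : Type*) [PartialOrder α] : Prop :=
  ∀ a b : α, (∃ c, IsLUB {a, b} c) ∧ ∃ c, IsGLB {a, b} c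

/-- Extremality: the largest length of a chain `x₀ < ⋯ < x_r` equals the number of join irreducible
elements and the number of meet irreducible elements. -/
def IsExtremalLattice (L : Type*) [Lattice L] : Prop :=
  Order.krullDim L = (Nat.card {x : L // SupIrred x} : ℕ) ∧
  Order.krullDim L = (Nat.card {x : L // InfIrred x} : ℕ)

/-- A left modular element. -/
def IsLeftModularElt {L : Type*} [Lattice L] (x : L) : Prop :=
  ∀ y z : L, y ≤ z → (y ⊔ x) ⊓ z = y ⊔ (x ⊓ z)

/-- A left modular lattice: some maximal chain consists of left modular elements. -/
def IsLeftModularLattice (L : Type*) [Lattice L] : Prop :=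
  ∃ c : Set L, IsMaxChain (· ≤ ·) c ∧ ∀ x ∈ c, IsLeftModularElt x

/-- A trim lattice (used for finite lattices): extremal and left modular. -/
def IsTrimLattice (L : Type*) [Lattice L] : Prop :=
  IsExtremalLattice L ∧ IsLeftModularLattice L

namespace AcyclicDigraph

variable {V : Type u} {G : AcyclicDigraph V}

/-! ### Basic notions -/

/-! Reflexive adjacency `Near` gives a Galois connection between sets of vertices, with polars
`lperp` and `rperp`; its closed pairs are the maximal orthogonal pairs. A tight pair is determined
by either component: `D` is the kernel of `lperp U`, and every independent set occurs as a `U`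
(`Tops.mem_D_iff`, `exists_top_U`). Everything turns on when a tight pair is `Good`, that is, when
`(lperp U, rperp D)` is itself a maximal orthogonal pair. If all tight pairs are good, sending a
pair to this one is an order embedding of `top(G)` into `L(G)` (`Tops.toMops`).

If `top(G)` is a lattice, goodness follows from `not_near_of_le`. Flips are cover relations
(`Flip.eq_of_lt_of_le`); starting from the pair with `D = {x}`, vertices of `U` are flipped away in
order of increasing rank, and joins show that each stage is the least element with its property.
Below a pair with `U = {y}` this process keeps `x` in `D` and reaches a stage with `y` in `U`. Joins
also make the embedding surjective (`Tops.nonempty_orderIso`).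

The graph is visible in `L(G)`: join irreducibles and meet irreducibles are both indexed by
vertices, and comparing one with the other reads off `Near`. An isomorphism of such lattices
therefore gives two bijections of vertices, which acyclicity forces to agree (`isIsoTo_of_mops`).

In a trim lattice, the steps of a left modular maximal chain label the join irreducibles and the
meet irreducibles; extremality makes both labellings bijective (`IsTrimLattice.exists_labelling`).
The Galois graph of this labelling has the given lattice as its lattice of maximal orthogonal pairs,
and left modularity supplies goodness through `ChainLabelling.exists_not_j_le_m`. Uniqueness then
reduces to the first two statements. -/

/-- `a` equals `b` or there is an edge from `a` to `b`. -/
def Near (G : AcyclicDigraph V) (a b : V) : Prop := a = b ∨ G.Adj a b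

theorem Near.refl (a : V) : G.Near a a := Or.inl rfl

theorem Near.geq {a b : V} (h : G.Near a b) : G.Geq a b := by
  rcases h with rfl | h
  · exact Relation.ReflTransGen.refl
  · exact .single h

theorem irrefl (a : V) : ¬ G.Adj a a := fun h => G.acyclic a (.single h)

theorem geq_of_adj {a b : V} (h : G.Adj a b) : G.Geq a b := .single h

theorem Geq.refl (a : V) : G.Geq a a := Relation.ReflTransGen.refl

theorem Geq.trans {a b c : V} (h : G.Geq a b) (h' : G.Geq b c) : G.Geq a c :=
  Relation.ReflTransGen.trans h h'

theorem Near.antisymm {a b : V} (h : G.Near a b) (h' : G.Near b a) : a = b :=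
  Geq.antisymm h.geq h'.geq

/-- The vertices that are neither in `A` nor the target of an edge from `A`. -/
def rperp (G : AcyclicDigraph V) (A : Set V) : Set V := {y | ∀ x ∈ A, ¬ G.Near x y}

/-- The vertices that are neither in `B` nor the source of an edge to `B`. -/
def lperp (G : AcyclicDigraph V) (B : Set V) : Set V := {x | ∀ y ∈ B, ¬ G.Near x y}

theorem isOrth_iff {X Y : Set V} : G.IsOrth X Y ↔ ∀ x ∈ X, ∀ y ∈ Y, ¬ G.Near x y := by
  constructor
  · rintro ⟨h1, h2⟩ x hx y hy (rfl | h)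
    · exact Set.disjoint_left.1 h1 hx hy
    · exact h2 x hx y hy h
  · intro h
    exact ⟨Set.disjoint_left.2 fun x hx hy => h x hx x hy (Near.refl x),
      fun x hx y hy hxy => h x hx y hy (Or.inr hxy)⟩

/-- The graph with all edges reversed. -/
def op (G : AcyclicDigraph V) : AcyclicDigraph V where
  Adj a b := G.Adj b a
  acyclic v h := G.acyclic v (Relation.transGen_swap.1 h)

theorem op_geq {a b : V} : G.op.Geq a b ↔ G.Geq b a :=
  Relation.reflTransGen_swap

theorem op_near {a b : V} : G.op.Near a b ↔ G.Near b a := by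
  unfold Near
  rw [eq_comm]
  rfl

theorem op_lperp (A : Set V) : G.op.lperp A = G.rperp A := by
  ext; simp [rperp, lperp, op_near]

theorem op_isIndep {A : Set V} : G.op.IsIndep A ↔ G.IsIndep A :=
  ⟨fun h a ha b hb => h b hb a ha, fun h a ha b hb => h b hb a ha⟩

/-! ### Ranks and kernels -/

/-- A numbering of the vertices that decreases along edges. -/
structure Rank (G : AcyclicDigraph V) where
  n : ℕ
  e : V ≃ Fin n
  lt : ∀ {a b}, G.Adj a b → e b < e a

theorem exists_rank [Finite V] (G : AcyclicDigraph V) : Nonempty G.Rank := by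
  classical
  have hpo : IsPartialOrder V (fun a b => G.Geq b a) :=
    { refl := fun a => Geq.refl a
      trans := fun a b c hab hbc => Geq.trans hbc hab
      antisymm := fun a b hab hba => Geq.antisymm hba hab }
  obtain ⟨s, hs, hle⟩ := extend_partialOrder (fun a b : V => G.Geq b a)
  cases nonempty_fintype V
  let L : LinearOrder V :=
    { le := s
      le_refl := refl_of s
      le_trans := fun a b c => trans_of s
      le_antisymm := fun a b => antisymm_of s
      le_total := total_of s
      toDecidableLE := Classical.decRel _ }
  let f := monoEquivOfFin V rfl
  refine ⟨⟨Fintype.card V, f.symm.toEquiv, fun {a b} h => ?_⟩⟩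
  have h1 : b ≤ a := hle _ _ (geq_of_adj h)
  have h2 : b ≠ a := fun e => irrefl a (e ▸ h)
  exact f.symm.strictMono (lt_of_le_of_ne h1 h2)

/-- The number of a vertex. -/
def Rank.r (ρ : G.Rank) (a : V) : ℕ := (ρ.e a : ℕ)

theorem Rank.inj (ρ : G.Rank) {a b : V} (h : ρ.r a = ρ.r b) : a = b :=
  ρ.e.injective (Fin.ext h)

theorem Rank.r_lt (ρ : G.Rank) {a b : V} (h : G.Adj a b) : ρ.r b < ρ.r a := ρ.lt h

theorem Rank.le (ρ : G.Rank) {a b : V} (h : G.Geq a b) : ρ.r b ≤ ρ.r a := by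
  induction h with
  | refl => exact le_rfl
  | tail _ h ih => exact (ρ.r_lt h).le.trans ih

theorem Rank.lt_of_ne (ρ : G.Rank) {a b : V} (h : G.Geq a b) (hne : a ≠ b) : ρ.r b < ρ.r a :=
  lt_of_le_of_ne (ρ.le h) fun e => hne (ρ.inj e).symm

theorem exists_linearExtension [Finite V] (G : AcyclicDigraph V) :
    ∃ ℓ ℓ' : List V, G.IsLinearExtension ℓ ∧ G.IsReverseLinearExtension ℓ' := by
  obtain ⟨ρ⟩ := G.exists_rank
  have key : (List.ofFn ρ.e.symm).Pairwise (fun a b => ¬ G.Geq a b) := by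
    rw [List.pairwise_ofFn]
    intro i j hij h
    have := ρ.le h
    simp only [Rank.r, Equiv.apply_symm_apply, Fin.val_fin_le] at this
    exact absurd hij this.not_gt
  refine ⟨List.ofFn ρ.e.symm, (List.ofFn ρ.e.symm).reverse, ⟨fun v => ?_, key⟩, fun v => ?_, ?_⟩
  · rw [List.mem_ofFn]
    exact ⟨ρ.e v, by simp⟩
  · rw [List.mem_reverse, List.mem_ofFn]
    exact ⟨ρ.e v, by simp⟩
  · exact List.pairwise_reverse.2 key

/-- The independent subset of `S` that dominates `S` from above. -/
theorem exists_kernel [Finite V] (G : AcyclicDigraph V) (S : Set V) :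
    ∃ K : Set V, ∀ k, k ∈ K ↔ k ∈ S ∧ ∀ d ∈ K, ¬ G.Adj d k := by
  obtain ⟨ρ⟩ := G.exists_rank
  have wf : WellFounded (fun a b : V => G.Adj a b) := by
    refine Subrelation.wf ?_ (measure fun a => ρ.n - ρ.r a).wf
    intro x y h
    have h1 := ρ.r_lt h
    have h2 : ρ.r x < ρ.n := (ρ.e x).2
    show ρ.n - ρ.r x < ρ.n - ρ.r y
    omega
  let K : V → Prop := wf.fix (fun k ih => k ∈ S ∧ ∀ d (h : G.Adj d k), ¬ ih d h)
  refine ⟨{k | K k}, fun k => ?_⟩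
  have : K k = (k ∈ S ∧ ∀ d, G.Adj d k → ¬ K d) := wf.fix_eq _ k
  show K k ↔ _
  rw [this]
  exact and_congr_right fun _ => ⟨fun h d hd hdk => h d hdk hd, fun h d hdk hd => h d hd hdk⟩

/-- Membership of `k` depends only on the sources of edges into `k`. These have larger rank, so
induction from the highest rank downward decides it. -/
theorem kernel_unique [Finite V] {S K K' : Set V}
    (h : ∀ k, k ∈ K ↔ k ∈ S ∧ ∀ d ∈ K, ¬ G.Adj d k)
    (h' : ∀ k, k ∈ K' ↔ k ∈ S ∧ ∀ d ∈ K', ¬ G.Adj d k) : K = K' := by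
  obtain ⟨ρ⟩ := G.exists_rank
  have : ∀ m : ℕ, ∀ k, ρ.n - ρ.r k = m → (k ∈ K ↔ k ∈ K') := by
    intro m
    induction m using Nat.strong_induction_on with
    | _ m ih =>
      rintro k rfl
      rw [h, h']
      refine and_congr_right fun _ => forall_congr' fun d => ?_
      by_cases hd : G.Adj d k
      · have h1 := ρ.r_lt hd
        have h2 : ρ.r d < ρ.n := (ρ.e d).2
        rw [ih _ (by omega) d rfl]
      · simp [hd]
  ext k
  exact this _ k rfl

/-! ### Tops -/

theorem Tops.indepD (t : G.Tops) {a b : V} (ha : a ∈ t.D) (hb : b ∈ t.D) : ¬ G.Adj a b :=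
  t.orth.1 a ha b hb

theorem Tops.indepU (t : G.Tops) {a b : V} (ha : a ∈ t.U) (hb : b ∈ t.U) : ¬ G.Adj a b :=
  t.orth.2.1 a ha b hb

theorem Tops.disj (t : G.Tops) {a : V} (ha : a ∈ t.D) (hb : a ∈ t.U) : False :=
  Set.disjoint_left.1 t.orth.2.2.1 ha hb

theorem Tops.not_adj (t : G.Tops) {a b : V} (ha : a ∈ t.D) (hb : b ∈ t.U) : ¬ G.Adj a b :=
  t.orth.2.2.2 a ha b hb

theorem Tops.not_near (t : G.Tops) {a b : V} (ha : a ∈ t.D) (hb : b ∈ t.U) : ¬ G.Near a b := by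
  rintro (rfl | h)
  · exact t.disj ha hb
  · exact t.not_adj ha hb h

/-- In a tight pair, every vertex outside `D` and `U` is below `D` or above `U`. -/
theorem Tops.cover (t : G.Tops) (k : V) :
    k ∈ t.D ∨ k ∈ t.U ∨ (∃ d ∈ t.D, G.Adj d k) ∨ ∃ u ∈ t.U, G.Adj k u := by
  by_contra! h
  obtain ⟨hD, hU, h1, h2⟩ := h
  refine t.tight.1 k hD {s | s ∈ t.D ∧ G.Gtr k s} (fun s hs => hs.1) (fun s hs => hs.2)
    ⟨?_, t.orth.2.1, ?_, ?_⟩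
  · rintro a (rfl | ⟨ha, ha'⟩) b (rfl | ⟨hb, hb'⟩)
    · exact irrefl _
    · exact fun h' => hb' ⟨hb, .single h', fun e => hD (e ▸ hb)⟩
    · exact h1 a ha
    · exact t.indepD ha hb
  · rw [Set.disjoint_left]
    rintro a (rfl | ⟨ha, -⟩) haU
    · exact hU haU
    · exact t.disj ha haU
  · rintro a (rfl | ⟨ha, -⟩) u hu
    · exact h2 u hu
    · exact t.not_adj ha hu

/-- A covering orthogonal pair of independent sets is tight. -/
def Tops.mk' (D U : Set V) (h : G.IsOrthIndep D U)
    (hc : ∀ k, k ∉ D → k ∉ U → (∀ d ∈ D, ¬ G.Adj d k) → (∀ u ∈ U, ¬ G.Adj k u) → False) :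
    G.Tops where
  D := D
  U := U
  orth := h
  tight := by
    constructor
    · rintro k hk S - hS ⟨h1, -, h3, h4⟩
      refine hc k hk (Set.disjoint_left.1 h3 (Set.mem_insert _ _)) (fun d hd hdk => ?_)
        fun u hu => h4 k (Set.mem_insert _ _) u hu
      by_cases hdS : d ∈ S
      · exact (hS d hdS).2 (Geq.antisymm (hS d hdS).1 (.single hdk))
      · exact h1 d (Set.mem_insert_of_mem _ ⟨hd, hdS⟩) k (Set.mem_insert _ _) hdk
    · rintro k hk S - hS ⟨-, h2, h3, h4⟩
      refine hc k (Set.disjoint_right.1 h3 (Set.mem_insert _ _)) hk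
        (fun d hd => h4 d hd k (Set.mem_insert _ _)) fun u hu hku => ?_
      by_cases huS : u ∈ S
      · exact (hS u huS).2 (Geq.antisymm (hS u huS).1 (.single hku))
      · exact h2 k (Set.mem_insert _ _) u (Set.mem_insert_of_mem _ ⟨hu, huS⟩) hku

/-- The tight pair of the reversed graph. -/
def Tops.op (t : G.Tops) : G.op.Tops :=
  Tops.mk' t.U t.D
    ⟨op_isIndep.2 t.orth.2.1, op_isIndep.2 t.orth.1, t.orth.2.2.1.symm,
      fun d hd u hu => t.orth.2.2.2 u hu d hd⟩
    fun k h1 h2 h3 h4 => by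
      rcases t.cover k with h | h | ⟨d, hd, h⟩ | ⟨u, hu, h⟩
      · exact h2 h
      · exact h1 h
      · exact h4 d hd h
      · exact h3 u hu h

/-- This is the kernel equation for `D` in `lperp U`; with `kernel_unique` it shows that `U`
determines the pair. -/
theorem Tops.mem_D_iff (t : G.Tops) (k : V) :
    k ∈ t.D ↔ k ∈ G.lperp t.U ∧ ∀ d ∈ t.D, ¬ G.Adj d k := by
  constructor
  · exact fun h => ⟨fun u hu => t.not_near h hu, fun d hd => t.indepD hd h⟩
  · rintro ⟨h1, h2⟩
    rcases t.cover k with h | h | ⟨d, hd, h⟩ | ⟨u, hu, h⟩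
    · exact h
    · exact absurd (Near.refl k) (h1 k h)
    · exact absurd h (h2 d hd)
    · exact absurd (Or.inr h) (h1 u hu)

theorem Tops.ext_U [Finite V] {t t' : G.Tops} (h : t.U = t'.U) : t = t' := by
  refine Tops.ext (kernel_unique (G := G) t.mem_D_iff ?_) h
  rw [h]
  exact t'.mem_D_iff

theorem Tops.ext_D [Finite V] {t t' : G.Tops} (h : t.D = t'.D) : t = t' := by
  have : t.op = t'.op := Tops.ext_U (G := G.op) h
  exact Tops.ext h (congrArg Tops.D this)

theorem exists_top_U [Finite V] {U : Set V} (hU : G.IsIndep U) : ∃ t : G.Tops, t.U = U := by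
  obtain ⟨K, hK⟩ := G.exists_kernel (G.lperp U)
  refine ⟨Tops.mk' K U ⟨fun a ha b hb => ((hK b).1 hb).2 a ha, hU, ?_, ?_⟩ ?_, rfl⟩
  · exact Set.disjoint_left.2 fun a ha ha' => ((hK a).1 ha).1 a ha' (Near.refl a)
  · exact fun d hd u hu h => ((hK d).1 hd).1 u hu (Or.inr h)
  · intro k h1 h2 h3 h4
    refine h1 ((hK k).2 ⟨?_, h3⟩)
    rintro u hu (rfl | h)
    · exact h2 hu
    · exact h4 u hu h

theorem exists_top_D [Finite V] {D : Set V} (hD : G.IsIndep D) : ∃ t : G.Tops, t.D = D := by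
  obtain ⟨t, ht⟩ := exists_top_U (op_isIndep.2 hD)
  exact ⟨t.op, ht⟩

theorem isIndep_singleton (a : V) : G.IsIndep {a} := by
  rintro x rfl y h
  exact (Set.mem_singleton_iff.1 h) ▸ irrefl _

/-! ### Flips -/

/-- `t'` is the flip of `t` at `g ∈ t.U`. -/
structure Flip (g : V) (t t' : G.Tops) : Prop where
  memU : g ∈ t.U
  memD : g ∈ t'.D
  D_iff : ∀ k, ¬ G.Geq g k → (k ∈ t'.D ↔ k ∈ t.D)
  U_iff : ∀ k, ¬ G.Geq k g → (k ∈ t'.U ↔ k ∈ t.U)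

theorem Flip.op {g : V} {t t' : G.Tops} (h : Flip g t t') : Flip g t'.op t.op where
  memU := h.memD
  memD := h.memU
  D_iff k hk := (h.U_iff k fun h' => hk (op_geq.2 h')).symm
  U_iff k hk := (h.D_iff k fun h' => hk (op_geq.2 h')).symm

/-- The preserved vertices together with `g` are completed by two kernels: first in the vertices
below `g` still allowed in `D`, then, with edges reversed, in the vertices above `g` still allowed
in `U`. Vertices incomparable to `g` remain covered by preserved ones. -/
theorem exists_flip [Finite V] (t : G.Tops) {g : V} (hg : g ∈ t.U) : ∃ t', Flip g t t' := by
  obtain ⟨K, hK⟩ := G.exists_kernel {k | G.Geq g k ∧ k ≠ g ∧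
    (∀ u ∈ t.U, ¬ G.Geq u g → ¬ G.Near k u) ∧ ¬ G.Adj g k ∧
    ∀ d ∈ t.D, ¬ G.Geq g d → ¬ G.Adj d k}
  let D' : Set V := {k | (k ∈ t.D ∧ ¬ G.Geq g k) ∨ k = g ∨ k ∈ K}
  obtain ⟨K', hK'⟩ := G.op.exists_kernel {k | G.Geq k g ∧ k ≠ g ∧
    (∀ d ∈ D', ¬ G.Near d k) ∧ ∀ u ∈ t.U, ¬ G.Geq u g → ¬ G.Adj k u}
  let U' : Set V := {k | (k ∈ t.U ∧ ¬ G.Geq k g) ∨ k ∈ K'}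
  have hD' : G.IsIndep D' := by
    rintro a (⟨ha, ha'⟩ | rfl | ha) b (⟨hb, hb'⟩ | rfl | hb) hab
    · exact t.indepD ha hb hab
    · exact t.not_adj ha hg hab
    · exact ((hK b).1 hb).1.2.2.2.2 a ha ha' hab
    · exact hb' (geq_of_adj hab)
    · exact irrefl _ hab
    · exact ((hK b).1 hb).1.2.2.2.1 hab
    · exact hb' (((hK a).1 ha).1.1.tail hab)
    · exact ((hK a).1 ha).1.2.1 (Geq.antisymm (geq_of_adj hab) ((hK a).1 ha).1.1)
    · exact ((hK b).1 hb).2 a ha hab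
  have hU' : G.IsIndep U' := by
    rintro a (⟨ha, ha'⟩ | ha) b (⟨hb, hb'⟩ | hb) hab
    · exact t.indepU ha hb hab
    · exact ha' ((geq_of_adj hab).trans ((hK' b).1 hb).1.1)
    · exact ((hK' a).1 ha).1.2.2.2 b hb hb' hab
    · exact ((hK' a).1 ha).2 b hb hab
  have hDU : ∀ d ∈ D', ∀ u ∈ U', ¬ G.Near d u := by
    rintro d hd u (⟨hu, hu'⟩ | hu)
    · rcases hd with ⟨hd, -⟩ | rfl | hd
      · exact t.not_near hd hu
      · rintro (rfl | h)
        · exact hu' (Geq.refl _)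
        · exact t.indepU hg hu h
      · exact ((hK d).1 hd).1.2.2.1 u hu hu'
    · exact ((hK' u).1 hu).1.2.2.1 d hd
  refine ⟨Tops.mk' D' U' ⟨hD', hU', ?_, fun d hd u hu h => hDU d hd u hu (Or.inr h)⟩ ?_,
    hg, Or.inr (Or.inl rfl), fun k hk => ⟨?_, fun h => Or.inl ⟨h, hk⟩⟩,
    fun k hk => ⟨?_, fun h => Or.inl ⟨h, hk⟩⟩⟩
  · exact Set.disjoint_left.2 fun a ha ha' => hDU a ha a ha' (Near.refl a)
  · intro k h1 h2 h3 h4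
    have hkg : k ≠ g := fun e => h1 (Or.inr (Or.inl e))
    by_cases hgk : G.Geq g k
    · refine h1 (Or.inr (Or.inr ((hK k).2 ⟨⟨hgk, hkg, ?_, h3 g (Or.inr (Or.inl rfl)), ?_⟩, ?_⟩)))
      · rintro u hu hu' (rfl | h)
        · exact h2 (Or.inl ⟨hu, hu'⟩)
        · exact h4 u (Or.inl ⟨hu, hu'⟩) h
      · exact fun d hd hd' => h3 d (Or.inl ⟨hd, hd'⟩)
      · exact fun d hd => h3 d (Or.inr (Or.inr hd))
    · by_cases hkg' : G.Geq k g
      · refine h2 (Or.inr ((hK' k).2 ⟨⟨hkg', hkg, ?_, ?_⟩, ?_⟩))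
        · rintro d hd (rfl | h)
          · exact h1 hd
          · exact h3 d hd h
        · exact fun u hu hu' => h4 u (Or.inl ⟨hu, hu'⟩)
        · exact fun u hu => h4 u (Or.inr hu)
      · rcases t.cover k with h | h | ⟨d, hd, h⟩ | ⟨u, hu, h⟩
        · exact h1 (Or.inl ⟨h, hgk⟩)
        · exact h2 (Or.inl ⟨h, hkg'⟩)
        · exact h3 d (Or.inl ⟨hd, fun h' => hgk (h'.tail h)⟩) h
        · exact h4 u (Or.inl ⟨hu, fun h' => hkg' ((geq_of_adj h).trans h')⟩) h
  · rintro (h | rfl | h)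
    · exact h.1
    · exact absurd (Geq.refl _) hk
    · exact absurd ((hK k).1 h).1.1 hk
  · rintro (h | h)
    · exact h.1
    · exact absurd ((hK' k).1 h).1.1 hk

theorem exists_flip_down [Finite V] (t : G.Tops) {g : V} (hg : g ∈ t.D) : ∃ t', Flip g t' t := by
  obtain ⟨t', h⟩ := exists_flip t.op hg
  exact ⟨t'.op, h.op⟩

/-! ### The greedy procedure computes the flip. -/

theorem greedy_eq {ok : V → Set V → Prop} {T : Set V} {l : List V} {A : Set V}
    (hA : A ⊆ T) (hl : ∀ v ∈ T, v ∈ A ∨ v ∈ l)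
    (h1 : ∀ k ∈ T, ∀ B ⊆ T, A ⊆ B → k ∉ B → ok k B)
    (h2 : ∀ l₁ k l₂, l = l₁ ++ k :: l₂ → k ∉ T →
      ∀ B, A ⊆ B → (∀ x ∈ T, x ∈ l₁ → x ∈ B) → ¬ ok k B) :
    greedy ok l A = T := by
  induction l generalizing A with
  | nil => exact hA.antisymm fun v hv => (hl v hv).resolve_right (by simp)
  | cons k l ih =>
    have hAk : A ⊆ A ∪ {x | x = k ∧ ok k A} := Set.subset_union_left
    refine ih ?_ ?_ ?_ ?_
    · rintro x (hx | ⟨rfl, hx⟩)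
      · exact hA hx
      · by_contra hx'
        exact h2 [] x l rfl hx' A subset_rfl (by simp) hx
    · intro v hv
      rcases hl v hv with h | h
      · exact Or.inl (hAk h)
      · rcases List.mem_cons.1 h with rfl | h
        · by_cases hvA : v ∈ A
          · exact Or.inl (hAk hvA)
          · exact Or.inl (Or.inr ⟨rfl, h1 v hv A hA subset_rfl hvA⟩)
        · exact Or.inr h
    · exact fun x hx B hB hAB => h1 x hx B hB (hAk.trans hAB)
    · intro l₁ x l₂ e hx B hAB hB
      refine h2 (k :: l₁) x l₂ (by rw [e]; rfl) hx B (hAk.trans hAB) fun y hy hyl => ?_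
      rcases List.mem_cons.1 hyl with rfl | hyl
      · by_cases hyA : y ∈ A
        · exact hAB (hAk hyA)
        · exact hAB (Or.inr ⟨rfl, h1 y hy A hA subset_rfl hyA⟩)
      · exact hB y hy hyl

/-- A vertex outside the target set is rejected because `t'.cover` provides an obstruction, which is
either a preserved vertex or one listed earlier. Hence the conditions in `Flip` determine `t'`, and
the choice of linear extensions is irrelevant. -/
theorem Flip.flip_eq {g : V} {t t' : G.Tops} (h : Flip g t t') {ℓ ℓ' : List V}
    (hℓ : G.IsLinearExtension ℓ) (hℓ' : G.IsReverseLinearExtension ℓ') :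
    G.flip ℓ ℓ' g t.D t.U = (t'.D, t'.U) := by
  have hU₀ : {k | k ∈ t.U ∧ ¬ G.Geq k g} ⊆ t'.U := fun k hk => (h.U_iff k hk.2).2 hk.1
  have hD₁ : greedy (fun k D => ¬ G.Geq k g ∧
      G.IsOrthIndep (insert k D) {k | k ∈ t.U ∧ ¬ G.Geq k g}) ℓ'
      (insert g {k | k ∈ t.D ∧ ¬ G.Geq g k}) = t'.D := by
    refine greedy_eq ?_ (fun v _ => Or.inr (hℓ'.1 v)) ?_ ?_
    · rintro k (rfl | ⟨hk, hk'⟩)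
      · exact h.memD
      · exact (h.D_iff k hk').2 hk
    · intro k hk B hB hAB hkB
      have hkg : k ≠ g := fun e => hkB (hAB (e ▸ Set.mem_insert _ _))
      have hgk : G.Geq g k := by
        by_contra hn
        exact hkB (hAB (Or.inr ⟨(h.D_iff k hn).1 hk, hn⟩))
      have hsub : insert k B ⊆ t'.D := Set.insert_subset hk hB
      exact ⟨fun hh => hkg (Geq.antisymm hh hgk),
        fun a ha b hb => t'.indepD (hsub ha) (hsub hb),
        fun a ha b hb => t.indepU ha.1 hb.1,
        Set.disjoint_left.2 fun a ha hb => t'.disj (hsub ha) (hU₀ hb),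
        fun a ha b hb => t'.not_adj (hsub ha) (hU₀ hb)⟩
    · rintro l₁ k l₂ e hk B hAB hB ⟨hkg, o1, o2, o3, o4⟩
      rcases t'.cover k with h' | h' | ⟨d, hd, h'⟩ | ⟨u, hu, h'⟩
      · exact hk h'
      · exact Set.disjoint_left.1 o3 (Set.mem_insert _ _) ⟨(h.U_iff k hkg).1 h', hkg⟩
      · have hd₁ : d ∈ l₁ := by
          have hm := hℓ'.1 d
          have hp := hℓ'.2
          rw [e] at hm hp
          rcases List.mem_append.1 hm with hm | hm
          · exact hm
          · rcases List.mem_cons.1 hm with rfl | hm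
            · exact absurd h' (irrefl _)
            · have := (List.pairwise_append.1 hp).2.1
              exact absurd (geq_of_adj h') ((List.pairwise_cons.1 this).1 d hm)
        exact o1 d (Or.inr (hB d hd hd₁)) k (Set.mem_insert _ _) h'
      · have hug : ¬ G.Geq u g := fun hh => hkg ((geq_of_adj h').trans hh)
        exact o4 k (Set.mem_insert _ _) u ⟨(h.U_iff u hug).1 hu, hug⟩ h'
  have hU₁ : greedy (fun k U => ¬ G.Geq g k ∧ G.IsOrthIndep t'.D (insert k U)) ℓ
      {k | k ∈ t.U ∧ ¬ G.Geq k g} = t'.U := by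
    refine greedy_eq hU₀ (fun v _ => Or.inr (hℓ.1 v)) ?_ ?_
    · intro k hk B hB hAB hkB
      have hkg : G.Geq k g := by
        by_contra hn
        exact hkB (hAB ⟨(h.U_iff k hn).1 hk, hn⟩)
      have hne : k ≠ g := fun e => t'.disj h.memD (e ▸ hk)
      have hsub : insert k B ⊆ t'.U := Set.insert_subset hk hB
      exact ⟨fun hh => hne (Geq.antisymm hkg hh), t'.orth.1,
        fun a ha b hb => t'.indepU (hsub ha) (hsub hb),
        Set.disjoint_left.2 fun a ha hb => t'.disj ha (hsub hb),
        fun a ha b hb => t'.not_adj ha (hsub hb)⟩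
    · rintro l₁ k l₂ e hk B hAB hB ⟨hkg, o1, o2, o3, o4⟩
      rcases t'.cover k with h' | h' | ⟨d, hd, h'⟩ | ⟨u, hu, h'⟩
      · exact Set.disjoint_left.1 o3 h' (Set.mem_insert _ _)
      · exact hk h'
      · exact o4 d hd k (Set.mem_insert _ _) h'
      · have hu₁ : u ∈ l₁ := by
          have hm := hℓ.1 u
          have hp := hℓ.2
          rw [e] at hm hp
          rcases List.mem_append.1 hm with hm | hm
          · exact hm
          · rcases List.mem_cons.1 hm with rfl | hm
            · exact absurd h' (irrefl _)
            · have := (List.pairwise_append.1 hp).2.1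
              exact absurd (geq_of_adj h') ((List.pairwise_cons.1 this).1 u hm)
        exact o2 k (Set.mem_insert _ _) u (Or.inr (hB u hu hu₁)) h'
  rw [AcyclicDigraph.flip, if_pos h.memU, complete]
  simp only [hD₁, hU₁]

theorem flipUp_iff [Finite V] {t t' : G.Tops} : t.FlipUp t' ↔ ∃ g, Flip g t t' := by
  constructor
  · rintro ⟨ℓ, ℓ', hℓ, hℓ', g, hg, h⟩
    obtain ⟨t'', h'⟩ := exists_flip t hg
    rw [h'.flip_eq hℓ hℓ', Prod.mk.injEq] at h
    exact ⟨g, Tops.ext h.1 h.2 ▸ h'⟩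
  · rintro ⟨g, h⟩
    obtain ⟨ℓ, ℓ', hℓ, hℓ'⟩ := G.exists_linearExtension
    exact ⟨ℓ, ℓ', hℓ, hℓ', g, h.memU, h.flip_eq hℓ hℓ'⟩

theorem Flip.ne {g : V} {t t' : G.Tops} (h : Flip g t t') : t ≠ t' := by
  rintro rfl
  exact t.disj h.memD h.memU

theorem Flip.lt [Finite V] {g : V} {t t' : G.Tops} (h : Flip g t t') : t < t' :=
  lt_of_le_of_ne (.single (flipUp_iff.2 ⟨g, h⟩)) h.ne

theorem Tops.le_induction [Finite V] {t : G.Tops} {P : G.Tops → Prop} (h0 : P t)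
    (hs : ∀ g a b, t ≤ a → Flip g a b → P a → P b) {t' : G.Tops} (h : t ≤ t') : P t' := by
  have h' : Relation.ReflTransGen Tops.FlipUp t t' := h
  induction h' with
  | refl => exact h0
  | tail h1 h2 ih =>
    obtain ⟨g, hg⟩ := flipUp_iff.1 h2
    exact hs g _ _ h1 hg (ih h1)

theorem Tops.op_le_op [Finite V] {t t' : G.Tops} (h : t ≤ t') : t'.op ≤ t.op :=
  Tops.le_induction (P := fun a => a.op ≤ t.op) le_rfl (fun _ _ _ _ hf ih => hf.op.lt.le.trans ih) h

instance [Finite V] : Finite G.Tops :=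
  Finite.of_injective Tops.D fun _ _ h => Tops.ext_D h

/-! ### Flips are cover relations -/

/-- A flip at `g` changes `D` only at ranks up to that of `g`, where `g` is added, and `U` only at
ranks from that of `g` on, where `g` is removed. The extreme changes along a sequence of flips are
thus of these two kinds. -/
theorem Tops.exists_extreme_change [Finite V] (ρ : G.Rank) {t t' : G.Tops} (h : t ≤ t') :
    t = t' ∨ ∃ a b, a ∉ t.D ∧ a ∈ t'.D ∧ (∀ k, ρ.r a < ρ.r k → (k ∈ t'.D ↔ k ∈ t.D)) ∧
      b ∈ t.U ∧ b ∉ t'.U ∧ (∀ k, ρ.r k < ρ.r b → (k ∈ t'.U ↔ k ∈ t.U)) ∧ ρ.r b ≤ ρ.r a := by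
  refine Tops.le_induction (P := fun t' => t = t' ∨ ∃ a b, a ∉ t.D ∧ a ∈ t'.D ∧
    (∀ k, ρ.r a < ρ.r k → (k ∈ t'.D ↔ k ∈ t.D)) ∧ b ∈ t.U ∧ b ∉ t'.U ∧
    (∀ k, ρ.r k < ρ.r b → (k ∈ t'.U ↔ k ∈ t.U)) ∧ ρ.r b ≤ ρ.r a) (Or.inl rfl) ?_ h
  intro g s s' _ hf ih
  right
  have hD : ∀ k, ρ.r g < ρ.r k → (k ∈ s'.D ↔ k ∈ s.D) := fun k hk =>
    hf.D_iff k fun h => (ρ.le h).not_gt hk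
  have hU : ∀ k, ρ.r k < ρ.r g → (k ∈ s'.U ↔ k ∈ s.U) := fun k hk =>
    hf.U_iff k fun h => (ρ.le h).not_gt hk
  have hgD : g ∉ s.D := fun h => s.disj h hf.memU
  have hgU : g ∉ s'.U := fun h => s'.disj hf.memD h
  rcases ih with rfl | ⟨a, b, a1, a2, a3, b1, b2, b3, hab⟩
  · exact ⟨g, g, hgD, hf.memD, hD, hf.memU, hgU, hU, le_rfl⟩
  · have ha : ∃ a', a' ∉ t.D ∧ a' ∈ s'.D ∧ (∀ k, ρ.r a' < ρ.r k → (k ∈ s'.D ↔ k ∈ t.D)) ∧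
        ρ.r a ≤ ρ.r a' ∧ ρ.r g ≤ ρ.r a' := by
      rcases lt_trichotomy (ρ.r a) (ρ.r g) with hl | he | hl
      · exact ⟨g, fun h => hgD ((a3 g hl).2 h), hf.memD,
          fun k hk => (hD k hk).trans (a3 k (hl.trans hk)), hl.le, le_rfl⟩
      · exact absurd (ρ.inj he ▸ a2) hgD
      · exact ⟨a, a1, (hD a hl).2 a2,
          fun k hk => (hD k (hl.trans hk)).trans (a3 k hk), le_rfl, hl.le⟩
    have hb : ∃ b', b' ∈ t.U ∧ b' ∉ s'.U ∧ (∀ k, ρ.r k < ρ.r b' → (k ∈ s'.U ↔ k ∈ t.U)) ∧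
        ρ.r b' ≤ ρ.r b := by
      rcases lt_trichotomy (ρ.r b) (ρ.r g) with hl | he | hl
      · exact ⟨b, b1, fun h => b2 ((hU b hl).1 h),
          fun k hk => (hU k (hk.trans hl)).trans (b3 k hk), le_rfl⟩
      · exact absurd hf.memU (ρ.inj he ▸ b2)
      · exact ⟨g, (b3 g hl).1 hf.memU, hgU,
          fun k hk => (hU k hk).trans (b3 k (hk.trans hl)), hl.le⟩
    obtain ⟨a', h1, h2, h3, h4, -⟩ := ha
    obtain ⟨b', g1, g2, g3, g4⟩ := hb
    exact ⟨a', b', h1, h2, h3, g1, g2, g3, g4.trans (hab.trans h4)⟩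

/-- Were `s` strictly between, the extreme changes of both steps would all be squeezed to the rank
of `g`; but one vertex cannot be added to `D` in both steps. -/
theorem Flip.eq_of_lt_of_le [Finite V] {g : V} {t s t' : G.Tops} (hf : Flip g t t')
    (h1 : t < s) (h2 : s ≤ t') : s = t' := by
  obtain ⟨ρ⟩ := G.exists_rank
  rcases Tops.exists_extreme_change ρ h1.le with h | ⟨a, b, a1, a2, a3, b1, b2, b3, hab⟩
  · exact absurd h h1.ne
  rcases Tops.exists_extreme_change ρ h2 with h | ⟨c, d, c1, c2, c3, d1, d2, d3, hcd⟩
  · exact h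
  exfalso
  have hD : ∀ k, (¬ (k ∈ t'.D ↔ k ∈ t.D)) → ρ.r k ≤ ρ.r g := fun k hk => by
    by_contra hn
    exact hk (hf.D_iff k fun h => (ρ.le h).not_gt (not_le.1 hn))
  have hU : ∀ k, (¬ (k ∈ t'.U ↔ k ∈ t.U)) → ρ.r g ≤ ρ.r k := fun k hk => by
    by_contra hn
    exact hk (hf.U_iff k fun h => (ρ.le h).not_gt (not_le.1 hn))
  have hac : ρ.r a ≠ ρ.r c := fun h => c1 (ρ.inj h ▸ a2)
  -- The higher of the two additions `a`, `c` is not undone by the other step, so it is a genuine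
  -- change from `t` to `t'`.
  have hmax : ρ.r a ≤ ρ.r g ∧ ρ.r c ≤ ρ.r g := by
    rcases lt_or_gt_of_ne hac with hl | hl
    · have := hD c fun h => c1 ((a3 c hl).2 (h.1 c2))
      exact ⟨hl.le.trans this, this⟩
    · have := hD a fun h => a1 (h.1 ((c3 a hl).2 a2))
      exact ⟨this, hl.le.trans this⟩
  have hbd : ρ.r b ≠ ρ.r d := fun h => b2 (ρ.inj h ▸ d1)
  have hmin : ρ.r g ≤ ρ.r b ∧ ρ.r g ≤ ρ.r d := by
    rcases lt_or_gt_of_ne hbd with hl | hl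
    · have := hU b fun h => b2 ((d3 b hl).1 (h.2 b1))
      exact ⟨this, this.trans hl.le⟩
    · have := hU d fun h => d2 (h.2 ((b3 d hl).1 d1))
      exact ⟨this.trans hl.le, this⟩
  omega

/-! ### Tight pairs with a singleton component -/

/-- Flipping `t` down at a vertex of `D` not below `x`, or, if there is none, at a vertex of `D`
other than `x`, keeps `x` in the polar of `U`. The descent stops only when `D = {x}`. -/
theorem Tops.le_of_mem_lperp [Finite V] {x : V} {s : G.Tops} (hs : s.D = {x}) (t : G.Tops)
    (hx : x ∈ G.lperp t.U) : s ≤ t := by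
  induction t using WellFoundedLT.induction with
  | ind t ih =>
  by_cases h : ∃ d ∈ t.D, ¬ G.Geq x d
  · obtain ⟨d, hd, hxd⟩ := h
    obtain ⟨t', hf⟩ := exists_flip_down t hd
    refine (ih t' hf.lt fun u hu hxu => ?_).trans hf.lt.le
    exact hx u ((hf.U_iff u fun h => hxd (hxu.geq.trans h)).2 hu) hxu
  · push Not at h
    have hxD : x ∈ t.D := (t.mem_D_iff x).2 ⟨hx, fun d hd hdx => by
      have := Geq.antisymm (h d hd) (geq_of_adj hdx)
      exact irrefl _ (this ▸ hdx)⟩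
    by_cases hall : ∀ d ∈ t.D, d = x
    · exact (Tops.ext_D (hs.trans (Set.eq_singleton_iff_unique_mem.2 ⟨hxD, hall⟩).symm)).le
    · push Not at hall
      obtain ⟨d, hd, hdx⟩ := hall
      obtain ⟨t', hf⟩ := exists_flip_down t hd
      have : x ∈ t'.D := (hf.D_iff x fun h' => hdx (Geq.antisymm h' (h d hd))).1 hxD
      exact (ih t' hf.lt ((t'.mem_D_iff x).1 this).1).trans hf.lt.le

theorem Tops.le_of_mem_rperp [Finite V] {y : V} {s : G.Tops} (hs : s.U = {y}) (t : G.Tops)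
    (hy : y ∈ G.rperp t.D) : t ≤ s := by
  have h : s.op ≤ t.op :=
    Tops.le_of_mem_lperp (G := G.op) (s := s.op) hs t.op (by rw [op_lperp]; exact hy)
  exact Tops.op_le_op h

/-! ### Goodness in the lattice case -/

/-- The tight pair `t` spans an orthogonal pair. -/
def Tops.Good (t : G.Tops) : Prop := ∀ x ∈ G.lperp t.U, ∀ y ∈ G.rperp t.D, ¬ G.Near x y

/-- `U` contains no vertex of rank below `i`. -/
def Tops.Above (ρ : G.Rank) (i : ℕ) (t : G.Tops) : Prop := ∀ u ∈ t.U, i ≤ ρ.r u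

theorem Tops.Above.mono [Finite V] {ρ : G.Rank} {i : ℕ} {t t' : G.Tops} (h : t.Above ρ i)
    (hle : t ≤ t') : t'.Above ρ i := by
  refine Tops.le_induction (P := fun s => s.Above ρ i) h ?_ hle
  intro g a b _ hf ha u hu
  by_cases hug : G.Geq u g
  · exact (ha g hf.memU).trans (ρ.le hug)
  · exact ha u ((hf.U_iff u hug).1 hu)

/-- Flipping down at vertices of `D` of rank at least `i` preserves `Above ρ i`. Every such descent
ends at the same pair. -/
theorem Tops.Above.exists_least [Finite V] {ρ : G.Rank} {i : ℕ} {t : G.Tops}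
    (ht : t.Above ρ i) :
    ∃ c : G.Tops, c.Above ρ i ∧ ∀ w : G.Tops, w.Above ρ i → c ≤ w := by
  have key : ∀ w : G.Tops, w.Above ρ i →
      ∃ c ≤ w, c.Above ρ i ∧ ∀ d ∈ c.D, ρ.r d < i := by
    intro w
    induction w using WellFoundedLT.induction with
    | ind w ih =>
    intro hw
    by_cases h : ∀ d ∈ w.D, ρ.r d < i
    · exact ⟨w, le_rfl, hw, h⟩
    · push Not at h
      obtain ⟨d, hd, hdi⟩ := h
      obtain ⟨w', hf⟩ := exists_flip_down w hd
      obtain ⟨c, h1, h2⟩ := ih w' hf.lt fun u hu => by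
        by_cases hud : G.Geq u d
        · exact hdi.trans (ρ.le hud)
        · exact hw u ((hf.U_iff u hud).2 hu)
      exact ⟨c, h1.trans hf.lt.le, h2⟩
  -- When `D` lies in ranks below `i`, it cannot cover a vertex of rank at least `i`, so `U` is the
  -- kernel, for reversed edges, of all these vertices.
  have hU : ∀ c : G.Tops, c.Above ρ i → (∀ d ∈ c.D, ρ.r d < i) →
      ∀ k, k ∈ c.U ↔ k ∈ {k | i ≤ ρ.r k} ∧ ∀ d ∈ c.U, ¬ G.op.Adj d k := by
    intro c h1 h2 k
    constructor
    · exact fun h => ⟨h1 k h, fun d hd h' => c.indepU h hd h'⟩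
    · rintro ⟨hk : i ≤ ρ.r k, hk'⟩
      rcases c.cover k with h | h | ⟨d, hd, h⟩ | ⟨u, hu, h⟩
      · exact absurd hk (h2 k h).not_ge
      · exact h
      · exact absurd (hk.trans (ρ.r_lt h).le) (h2 d hd).not_ge
      · exact absurd h (hk' u hu)
  obtain ⟨c, -, hc, hcD⟩ := key t ht
  refine ⟨c, hc, fun w hw => ?_⟩
  obtain ⟨c', h1, h2, h3⟩ := key w hw
  have : c = c' := Tops.ext_U (kernel_unique (G := G.op) (hU c hc hcD) (hU c' h2 h3))
  exact this ▸ h1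

theorem not_near_of_le [Finite V] (hL : IsLatticeOrder G.Tops) {x y : V} {s t : G.Tops}
    (hs : s.D = {x}) (ht : t.U = {y}) (hle : s ≤ t) : ¬ G.Near x y := by
  intro hxy
  obtain ⟨ρ⟩ := G.exists_rank
  have hyx : ρ.r y ≤ ρ.r x := ρ.le hxy.geq
  have htA : t.Above ρ (ρ.r y) := by
    intro u hu
    rw [ht, Set.mem_singleton_iff] at hu
    exact hu ▸ le_rfl
  -- By induction on `i`, the least pair above `s` whose `U` avoids ranks below `i` still has `x` in
  -- `D`: only vertices of rank less than that of `y`, hence of `x`, have been flipped.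
  have key : ∀ i ≤ ρ.r y, ∃ c : G.Tops, s ≤ c ∧ c.Above ρ i ∧ x ∈ c.D ∧
      ∀ w : G.Tops, s ≤ w → w.Above ρ i → c ≤ w := by
    intro i
    induction i with
    | zero =>
      exact fun _ => ⟨s, le_rfl, fun _ _ => Nat.zero_le _, hs ▸ rfl, fun w hw _ => hw⟩
    | succ i ih =>
      intro hi
      obtain ⟨c, hsc, hcA, hxc, hc⟩ := ih (by omega)
      by_cases hg : ∃ g ∈ c.U, ρ.r g = i
      · obtain ⟨g, hg, hgi⟩ := hg
        obtain ⟨c', hf⟩ := exists_flip c hg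
        have hc'A : c'.Above ρ (i + 1) := by
          intro u hu
          have h1 : i ≤ ρ.r u := hcA.mono hf.lt.le u hu
          have h2 : ρ.r u ≠ i := fun e => c'.disj hf.memD (ρ.inj (e.trans hgi.symm) ▸ hu)
          omega
        obtain ⟨e, heA, he⟩ := hc'A.exists_least
        obtain ⟨⟨j, hj⟩, -⟩ := hL c e
        -- The join of `c` with the least element `e` satisfying the next condition is at most the
        -- flip `c'` and differs from `c`. Since flips are covers it equals `c'`, which inherits
        -- leastness from the join.
        have hcj : c ≤ j := hj.1 (Or.inl rfl)
        have hej : e ≤ j := hj.1 (Or.inr rfl)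
        have hjc' : j ≤ c' := hj.2 (by
          rintro a (rfl | rfl)
          · exact hf.lt.le
          · exact he c' hc'A)
        have hne : c ≠ j := by
          rintro rfl
          have := heA.mono hej g hg
          omega
        have hjc : j = c' := hf.eq_of_lt_of_le (lt_of_le_of_ne hcj hne) hjc'
        subst hjc
        refine ⟨j, hsc.trans hcj, hc'A, (hf.D_iff x fun h => ?_).2 hxc, fun w hw hwA => ?_⟩
        · have := ρ.le h
          omega
        · refine hj.2 ?_
          rintro a (rfl | rfl)
          · exact hc w hw fun u hu => (Nat.le_succ i).trans (hwA u hu)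
          · exact he w hwA
      · refine ⟨c, hsc, fun u hu => ?_, hxc,
          fun w hw hwA => hc w hw fun u hu => (Nat.le_succ i).trans (hwA u hu)⟩
        have h1 := hcA u hu
        have h2 : ρ.r u ≠ i := fun h => hg ⟨u, hu, h⟩
        omega
  obtain ⟨c, hsc, hcA, hxc, hc⟩ := key _ le_rfl
  have hct : c ≤ t := hc t hle htA
  -- Otherwise `c` would satisfy the next condition, which passes up to `t` and contradicts `y ∈
  -- t.U`.
  have hyc : y ∈ c.U := by
    by_contra hyc
    have hcA' : c.Above ρ (ρ.r y + 1) := by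
      intro u hu
      have h1 := hcA u hu
      have h2 : ρ.r u ≠ ρ.r y := fun h => hyc (ρ.inj h ▸ hu)
      omega
    have := hcA'.mono hct y (ht ▸ rfl)
    omega
  exact c.not_near hxc hyc hxy

theorem Tops.good_of_isLatticeOrder [Finite V] (hL : IsLatticeOrder G.Tops) (t : G.Tops) :
    t.Good := by
  intro x hx y hy
  obtain ⟨s, hs⟩ := exists_top_D (isIndep_singleton (G := G) x)
  obtain ⟨s', hs'⟩ := exists_top_U (isIndep_singleton (G := G) y)
  exact not_near_of_le hL hs hs' ((Tops.le_of_mem_lperp hs t hx).trans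
    (Tops.le_of_mem_rperp hs' t hy))

/-! ### Maximal orthogonal pairs -/

theorem lperp_anti {A B : Set V} (h : A ⊆ B) : G.lperp B ⊆ G.lperp A :=
  fun _ hx _ hy => hx _ (h hy)

theorem rperp_anti {A B : Set V} (h : A ⊆ B) : G.rperp B ⊆ G.rperp A :=
  fun _ hy _ hx => hy _ (h hx)

theorem subset_lperp_iff {A B : Set V} : A ⊆ G.lperp B ↔ B ⊆ G.rperp A :=
  ⟨fun h _ hy _ hx => h hx _ hy, fun h _ hx _ hy => h hy _ hx⟩

theorem subset_lperp_rperp (A : Set V) : A ⊆ G.lperp (G.rperp A) :=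
  subset_lperp_iff.2 subset_rfl

theorem subset_rperp_lperp (B : Set V) : B ⊆ G.rperp (G.lperp B) :=
  subset_lperp_iff.1 subset_rfl

theorem isOrth_iff_subset {X Y : Set V} : G.IsOrth X Y ↔ X ⊆ G.lperp Y := isOrth_iff

theorem Mops.X_eq (p : G.Mops) : p.X = G.lperp p.Y :=
  (p.max_left _ (isOrth_iff_subset.1 p.orth) (isOrth_iff_subset.2 subset_rfl)).symm

theorem Mops.Y_eq (p : G.Mops) : p.Y = G.rperp p.X :=
  (p.max_right _ (subset_lperp_iff.1 (isOrth_iff_subset.1 p.orth))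
    (isOrth_iff_subset.2 (subset_lperp_rperp _))).symm

/-- A maximal orthogonal pair from two sets that determine each other. -/
def Mops.mk' (X Y : Set V) (hX : X = G.lperp Y) (hY : Y = G.rperp X) : G.Mops where
  X := X
  Y := Y
  orth := isOrth_iff_subset.2 hX.le
  max_left _ h h' := ((isOrth_iff_subset.1 h').trans hX.ge).antisymm h
  max_right _ h h' := ((subset_lperp_iff.1 (isOrth_iff_subset.1 h')).trans hY.ge).antisymm h

/-- The least maximal orthogonal pair with `A` in its first component. -/
def Mops.ofX (A : Set V) : G.Mops :=
  Mops.mk' (G.lperp (G.rperp A)) (G.rperp A) rfl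
    ((subset_rperp_lperp _).antisymm (rperp_anti (subset_lperp_rperp A)))

/-- The greatest maximal orthogonal pair with `B` in its second component. -/
def Mops.ofY (B : Set V) : G.Mops :=
  Mops.mk' (G.lperp B) (G.rperp (G.lperp B))
    ((subset_lperp_rperp _).antisymm (lperp_anti (subset_rperp_lperp B))) rfl

theorem Mops.ofX_le {A : Set V} {p : G.Mops} : Mops.ofX A ≤ p ↔ A ⊆ p.X := by
  constructor
  · exact (subset_lperp_rperp A).trans
  · intro h
    show G.lperp (G.rperp A) ⊆ p.X
    rw [p.X_eq]
    refine lperp_anti ?_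
    rw [p.Y_eq]
    exact rperp_anti h

theorem Mops.le_iff_Y {p q : G.Mops} : p ≤ q ↔ q.Y ⊆ p.Y := by
  constructor
  · exact Mops.Y_subset_of_X_subset
  · intro h
    show p.X ⊆ q.X
    rw [p.X_eq, q.X_eq]
    exact lperp_anti h

theorem Mops.le_ofY {B : Set V} {p : G.Mops} : p ≤ Mops.ofY B ↔ B ⊆ p.Y := by
  rw [p.Y_eq, ← subset_lperp_iff]
  rfl

theorem Mops.isLatticeOrder (G : AcyclicDigraph V) : IsLatticeOrder G.Mops := by
  intro p q
  refine ⟨⟨Mops.ofX (p.X ∪ q.X), ?_, fun r hr => Mops.ofX_le.2 (Set.union_subset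
    (hr (Or.inl rfl)) (hr (Or.inr rfl)))⟩, ⟨Mops.ofY (p.Y ∪ q.Y), ?_, fun r hr =>
    Mops.le_ofY.2 (Set.union_subset (Mops.le_iff_Y.1 (hr (Or.inl rfl)))
      (Mops.le_iff_Y.1 (hr (Or.inr rfl))))⟩⟩
  · have := (Mops.ofX_le (p := Mops.ofX (G := G) (p.X ∪ q.X))).1 le_rfl
    rintro a (rfl | rfl)
    · exact Set.subset_union_left.trans this
    · exact Set.subset_union_right.trans this
  · have := (Mops.le_ofY (p := Mops.ofY (G := G) (p.Y ∪ q.Y))).1 le_rfl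
    rintro a (rfl | rfl)
    · exact Mops.le_iff_Y.2 (Set.subset_union_left.trans this)
    · exact Mops.le_iff_Y.2 (Set.subset_union_right.trans this)

theorem IsLatticeOrder.of_orderIso {α β : Type*} [PartialOrder α] [PartialOrder β] (e : α ≃o β)
    (h : IsLatticeOrder β) : IsLatticeOrder α := by
  intro a b
  obtain ⟨⟨c, hc⟩, ⟨d, hd⟩⟩ := h (e a) (e b)
  have himg : e.symm '' {e a, e b} = {a, b} := by simp [Set.image_pair]
  exact ⟨⟨e.symm c, himg ▸ e.symm.isLUB_image'.2 hc⟩, ⟨e.symm d, himg ▸ e.symm.isGLB_image'.2 hd⟩⟩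

/-! ### From tight pairs to maximal orthogonal pairs -/

theorem Tops.D_subset (t : G.Tops) : t.D ⊆ G.lperp t.U := fun _ hd _ hu => t.not_near hd hu

theorem Tops.U_subset (t : G.Tops) : t.U ⊆ G.rperp t.D := subset_lperp_iff.1 t.D_subset

theorem Tops.Good.lperp_eq {t : G.Tops} (h : t.Good) : G.lperp t.U = G.lperp (G.rperp t.D) :=
  Set.Subset.antisymm h (lperp_anti t.U_subset)

theorem Tops.Good.rperp_eq {t : G.Tops} (h : t.Good) : G.rperp t.D = G.rperp (G.lperp t.U) :=
  (subset_lperp_iff.1 h).antisymm (rperp_anti t.D_subset)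

/-- The maximal orthogonal pair spanned by a good tight pair. -/
def Tops.Good.toMop {t : G.Tops} (h : t.Good) : G.Mops :=
  Mops.mk' (G.lperp t.U) (G.rperp t.D) h.lperp_eq h.rperp_eq

/-- A vertex `u` of `t'.U` that obstructs the inclusion lies above `g`. By goodness of `t` it is
near some `d ∈ t.D`; this `d` is not below `g`, so it survives in `t'.D`, against orthogonality of
`t'`. -/
theorem Flip.lperp_subset {g : V} {t t' : G.Tops} (hf : Flip g t t') (h : t.Good) :
    G.lperp t.U ⊆ G.lperp t'.U := by
  intro w hw u hu hwu
  have hug : G.Geq u g := by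
    by_contra hn
    exact hw u ((hf.U_iff u hn).1 hu) hwu
  have : u ∉ G.rperp t.D := fun h' => h w hw u h' hwu
  simp only [rperp, Set.mem_ofPred_eq, not_forall, not_not] at this
  obtain ⟨d, hd, hdu⟩ := this
  have hdg : ¬ G.Geq g d := fun h' => by
    have e := Geq.antisymm (hdu.geq.trans hug) h'
    subst e
    exact t.disj hd hf.memU
  exact t'.not_near ((hf.D_iff d hdg).2 hd) hu hdu

theorem Tops.lperp_mono [Finite V] (h : ∀ t : G.Tops, t.Good) {t t' : G.Tops} (hle : t ≤ t') :
    G.lperp t.U ⊆ G.lperp t'.U :=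
  Tops.le_induction (P := fun s => G.lperp t.U ⊆ G.lperp s.U) subset_rfl
    (fun _ a _ _ hf ih => ih.trans (hf.lperp_subset (h a))) hle

/-- A flip of `t` at the lowest vertex where `t.U` and `t'.U` differ keeps the inclusion of polars,
so `t` can climb by flips until it reaches `t'`. -/
theorem Tops.le_of_lperp_subset [Finite V] (h : ∀ t : G.Tops, t.Good) {t t' : G.Tops}
    (hsub : G.lperp t.U ⊆ G.lperp t'.U) : t ≤ t' := by
  obtain ⟨ρ⟩ := G.exists_rank
  induction t using WellFoundedGT.induction with
  | ind t ih =>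
  by_cases hUU : t.U = t'.U
  · exact (Tops.ext_U hUU).le
  have hY : G.rperp t'.D ⊆ G.rperp t.D := by
    rw [(h t).rperp_eq, (h t').rperp_eq]
    exact rperp_anti hsub
  have hex : ∃ v, ¬ (v ∈ t.U ↔ v ∈ t'.U) := by
    by_contra! hn
    exact hUU (Set.ext hn)
  obtain ⟨g, hg, hmin⟩ := exists_minimalFor_of_wellFoundedLT _ ρ.r hex
  have hlow : ∀ k, ρ.r k < ρ.r g → (k ∈ t.U ↔ k ∈ t'.U) := fun k hk => by
    by_contra hn
    exact (hmin hn hk.le).not_gt hk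
  -- If `g` were only in `t'.U`, the inclusion `hY` and the covering property of `t` would give an
  -- edge from `g` to a lower vertex of `t.U`. That vertex also lies in `t'.U`, which is
  -- independent.
  have hgU : g ∈ t.U := by
    by_contra hgU
    have hg' : g ∈ t'.U := by tauto
    have hgY := hY (t'.U_subset hg')
    rcases t.cover g with h' | h' | ⟨d, hd, h'⟩ | ⟨u, hu, h'⟩
    · exact hgY g h' (Near.refl g)
    · exact hgU h'
    · exact hgY d hd (Or.inr h')
    · exact t'.indepU hg' ((hlow u (ρ.r_lt h')).1 hu) h'
  have hgU' : g ∉ t'.U := by tauto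
  have hgX : g ∈ G.lperp t'.U := by
    rintro u hu (rfl | h')
    · exact hgU' hu
    · exact t.indepU hgU ((hlow u (ρ.r_lt h')).2 hu) h'
  obtain ⟨s, hf⟩ := exists_flip t hgU
  refine hf.lt.le.trans (ih s hf.lt ?_)
  have hsD : s.D ⊆ G.lperp t'.U := by
    intro e he
    by_cases hge : G.Geq g e
    · by_cases hne : g = e
      · exact hne ▸ hgX
      intro u hu heu
      have hlt : ρ.r u < ρ.r g := (ρ.le heu.geq).trans_lt (ρ.lt_of_ne hge hne)
      have hug : ¬ G.Geq u g := fun h' => (ρ.le h').not_gt hlt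
      exact s.not_near he ((hf.U_iff u hug).2 ((hlow u hlt).2 hu)) heu
    · exact hsub (t.D_subset ((hf.D_iff e hge).1 he))
  rw [(h s).lperp_eq]
  exact lperp_anti (subset_lperp_iff.1 hsD)

/-- If all tight pairs are good, then `top(G)` embeds into `L(G)`. -/
def Tops.toMops [Finite V] (h : ∀ t : G.Tops, t.Good) : G.Tops ↪o G.Mops :=
  OrderEmbedding.ofMapLEIff (fun t => (h t).toMop)
    fun _ _ => ⟨fun hle => Tops.le_of_lperp_subset h hle, fun hle => Tops.lperp_mono h hle⟩

/-- If `top(G)` is a lattice, it is isomorphic to `L(G)`. -/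
theorem Tops.nonempty_orderIso [Finite V] (hL : IsLatticeOrder G.Tops) :
    Nonempty (G.Tops ≃o G.Mops) := by
  have hgood := Tops.good_of_isLatticeOrder hL
  refine ⟨RelIso.ofSurjective (Tops.toMops hgood) fun p => ?_⟩
  -- The pair with `D = ∅` works: its first polar is the closure of the empty set, which is empty
  -- because `Near` is reflexive.
  have hex : ∃ t : G.Tops, G.lperp t.U ⊆ p.X := by
    obtain ⟨t, ht⟩ := exists_top_D (G := G) (D := ∅) (by rintro a ⟨⟩)
    refine ⟨t, ?_⟩
    rw [(hgood t).lperp_eq, ht]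
    exact fun x hx => absurd (Near.refl x) (hx x (by rintro _ ⟨⟩))
  obtain ⟨t, ht, hmax⟩ := exists_maximal_of_wellFoundedGT _ hex
  refine ⟨t, le_antisymm ht fun x hx => ?_⟩
  obtain ⟨s, hs⟩ := exists_top_D (isIndep_singleton (G := G) x)
  have hsX : G.lperp s.U ⊆ p.X := by
    rw [(hgood s).lperp_eq, hs]
    exact Mops.ofX_le.2 (Set.singleton_subset_iff.2 hx)
  obtain ⟨⟨j, hj⟩, -⟩ := hL t s
  -- For each `y ∈ p.Y`, the pair with `U = {y}` bounds `t` and `s`, hence their join `j`, so `y` is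
  -- orthogonal to `lperp j.U`.
  have hjX : G.lperp j.U ⊆ p.X := by
    rw [p.X_eq] at ht hsX ⊢
    intro z hz y hy
    obtain ⟨m, hm⟩ := exists_top_U (isIndep_singleton (G := G) y)
    have hym : m.U ⊆ p.Y := by rw [hm]; exact Set.singleton_subset_iff.2 hy
    have hjm : j ≤ m := hj.2 (by
      rintro a (rfl | rfl)
      · exact Tops.le_of_lperp_subset hgood (ht.trans (lperp_anti hym))
      · exact Tops.le_of_lperp_subset hgood (hsX.trans (lperp_anti hym)))
    exact Tops.lperp_mono hgood hjm hz y (hm ▸ rfl)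
  have hjt : j ≤ t := hmax hjX (hj.1 (Or.inl rfl))
  have hst : s ≤ t := (hj.1 (Or.inr rfl)).trans hjt
  exact Tops.lperp_mono hgood hst (s.D_subset (hs ▸ rfl))

variable {W : Type v} {H : AcyclicDigraph W}

/-! ### The graph is determined by the lattice of maximal orthogonal pairs -/

/-- There is a greatest element among those strictly below `p`. -/
def IsJoinIrred {α : Type*} [PartialOrder α] (p : α) : Prop := ∃ q < p, ∀ x < p, x ≤ q

/-- There is a least element among those strictly above `p`. -/
def IsMeetIrred {α : Type*} [PartialOrder α] (p : α) : Prop := ∃ q > p, ∀ x > p, q ≤ x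

theorem IsJoinIrred.map {α β : Type*} [PartialOrder α] [PartialOrder β] (e : α ≃o β) {p : α}
    (h : IsJoinIrred p) : IsJoinIrred (e p) := by
  obtain ⟨q, hq, h⟩ := h
  refine ⟨e q, e.lt_iff_lt.2 hq, fun x hx => ?_⟩
  rw [← e.symm_apply_le]
  exact h _ (e.symm_apply_lt.2 hx)

theorem IsMeetIrred.map {α β : Type*} [PartialOrder α] [PartialOrder β] (e : α ≃o β) {p : α}
    (h : IsMeetIrred p) : IsMeetIrred (e p) := by
  obtain ⟨q, hq, h⟩ := h
  refine ⟨e q, e.lt_iff_lt.2 hq, fun x hx => ?_⟩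
  rw [← e.le_symm_apply]
  exact h _ (e.lt_symm_apply.2 hx)

theorem isJoinIrred_map_iff {α β : Type*} [PartialOrder α] [PartialOrder β] (e : α ≃o β) {p : α} :
    IsJoinIrred (e p) ↔ IsJoinIrred p :=
  ⟨fun h => by simpa using h.map e.symm, fun h => h.map e⟩

theorem isMeetIrred_map_iff {α β : Type*} [PartialOrder α] [PartialOrder β] (e : α ≃o β) {p : α} :
    IsMeetIrred (e p) ↔ IsMeetIrred p :=
  ⟨fun h => by simpa using h.map e.symm, fun h => h.map e⟩

theorem Mops.ofX_singleton_le {v : V} {p : G.Mops} : Mops.ofX {v} ≤ p ↔ v ∈ p.X :=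
  Mops.ofX_le.trans Set.singleton_subset_iff

theorem Mops.le_ofY_singleton {v : V} {p : G.Mops} : p ≤ Mops.ofY {v} ↔ v ∈ p.Y :=
  Mops.le_ofY.trans Set.singleton_subset_iff

theorem Mops.ofX_le_ofY {a b : V} :
    Mops.ofX (G := G) {a} ≤ Mops.ofY {b} ↔ ¬ G.Near a b := by
  rw [Mops.le_ofY_singleton]
  constructor
  · exact fun h => h a rfl
  · rintro h _ rfl
    exact h

theorem Mops.near_of_mem_ofX {a w : V} (h : w ∈ (Mops.ofX (G := G) {a}).X) : G.Near a w := by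
  by_contra hn
  exact h w (by rintro _ rfl; exact hn) (Near.refl w)

theorem Mops.near_of_mem_ofY {a w : V} (h : w ∈ (Mops.ofY (G := G) {a}).Y) : G.Near w a := by
  by_contra hn
  exact h w (by rintro _ rfl; exact hn) (Near.refl w)

theorem Mops.ofX_injective : Function.Injective fun v : V => Mops.ofX (G := G) {v} := by
  intro a b h
  have h1 := Mops.near_of_mem_ofX (Mops.ofX_singleton_le.1 (h : Mops.ofX {a} = Mops.ofX {b}).le)
  have h2 := Mops.near_of_mem_ofX (Mops.ofX_singleton_le.1 (h : Mops.ofX {a} = Mops.ofX {b}).ge)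
  exact h2.antisymm h1

theorem Mops.ofY_injective : Function.Injective fun v : V => Mops.ofY (G := G) {v} := by
  intro a b h
  have h1 := Mops.near_of_mem_ofY (Mops.le_ofY_singleton.1 (h : Mops.ofY {a} = Mops.ofY {b}).le)
  have h2 := Mops.near_of_mem_ofY (Mops.le_ofY_singleton.1 (h : Mops.ofY {a} = Mops.ofY {b}).ge)
  exact h2.antisymm h1

/-- Every element is the join of the `Mops.ofX {v}` with `v` in its first component. The lower cover
of `Mops.ofX {v}` arises by adding `v` to its second component; antisymmetry of `Near` keeps `v`
orthogonal to anything strictly below. -/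
theorem Mops.isJoinIrred_iff {p : G.Mops} : IsJoinIrred p ↔ ∃ v, p = Mops.ofX {v} := by
  constructor
  · rintro ⟨q, hq, h⟩
    by_contra! hn
    refine hq.not_ge fun v hv => ?_
    exact Mops.ofX_singleton_le.1
      (h _ (lt_of_le_of_ne (Mops.ofX_singleton_le.2 hv) (hn v).symm))
  · rintro ⟨v, rfl⟩
    refine ⟨Mops.ofY ((Mops.ofX (G := G) {v}).Y ∪ {v}), ?_, ?_⟩
    · refine lt_of_le_of_ne (Mops.le_iff_Y.2 (Set.subset_union_left.trans (Mops.le_ofY.1 le_rfl)))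
        fun h => ?_
      have h1 : v ∈ (Mops.ofY (G := G) ((Mops.ofX (G := G) {v}).Y ∪ {v})).X := by
        rw [h]
        exact Mops.ofX_singleton_le.1 le_rfl
      exact h1 v (Or.inr rfl) (Near.refl v)
    · intro x hx
      rw [Mops.le_ofY]
      refine Set.union_subset (Mops.le_iff_Y.1 hx.le) (Set.singleton_subset_iff.2 ?_)
      rw [x.Y_eq]
      intro w hw hwv
      have h1 := Mops.near_of_mem_ofX (hx.le hw)
      have := hwv.antisymm h1
      subst this
      exact hx.not_ge (Mops.ofX_singleton_le.2 hw)

theorem Mops.isMeetIrred_iff {p : G.Mops} : IsMeetIrred p ↔ ∃ v, p = Mops.ofY {v} := by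
  constructor
  · rintro ⟨q, hq, h⟩
    by_contra! hn
    refine hq.not_ge (Mops.le_iff_Y.2 fun v hv => ?_)
    exact Mops.le_ofY_singleton.1
      (h _ (lt_of_le_of_ne (Mops.le_ofY_singleton.2 hv) (hn v)))
  · rintro ⟨v, rfl⟩
    refine ⟨Mops.ofX ((Mops.ofY (G := G) {v}).X ∪ {v}), ?_, ?_⟩
    · refine lt_of_le_of_ne (Set.subset_union_left.trans (Mops.ofX_le.1 le_rfl)) fun h => ?_
      have h1 : v ∈ (Mops.ofX (G := G) ((Mops.ofY (G := G) {v}).X ∪ {v})).Y := by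
        rw [← h]
        exact Mops.le_ofY_singleton.1 le_rfl
      exact h1 v (Or.inr rfl) (Near.refl v)
    · intro x hx
      rw [Mops.ofX_le]
      refine Set.union_subset hx.le (Set.singleton_subset_iff.2 ?_)
      rw [x.X_eq]
      intro w hw hvw
      have h1 := Mops.near_of_mem_ofY (Mops.le_iff_Y.1 hx.le hw)
      have := hvw.antisymm h1
      subst this
      exact hx.not_ge (Mops.le_ofY_singleton.2 hw)

/-- If `π w` differs from `w`, it has smaller rank and is fixed by induction, so injectivity is
violated. -/
theorem eq_id_of_geq [Finite W] {π : W → W} (hπ : Function.Injective π)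
    (h : ∀ w, H.Geq w (π w)) (w : W) : π w = w := by
  obtain ⟨ρ⟩ := H.exists_rank
  have : ∀ m : ℕ, ∀ w, ρ.r w = m → π w = w := by
    intro m
    induction m using Nat.strong_induction_on with
    | _ m ih =>
      rintro w rfl
      by_contra hne
      exact hne (hπ (ih _ (ρ.lt_of_ne (h w) (Ne.symm hne)) _ rfl))
  exact this _ w rfl

theorem isIsoTo_of_mops [Finite W] (e : G.Mops ≃o H.Mops) : G.IsIsoTo H := by
  have h1 : ∀ v, ∃ w, e (Mops.ofX {v}) = Mops.ofX {w} := fun v =>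
    Mops.isJoinIrred_iff.1 ((isJoinIrred_map_iff e).2 (Mops.isJoinIrred_iff.2 ⟨v, rfl⟩))
  have h2 : ∀ v, ∃ w, e (Mops.ofY {v}) = Mops.ofY {w} := fun v =>
    Mops.isMeetIrred_iff.1 ((isMeetIrred_map_iff e).2 (Mops.isMeetIrred_iff.2 ⟨v, rfl⟩))
  choose σ hσ using h1
  choose τ hτ using h2
  have hσi : Function.Injective σ := fun a b h =>
    Mops.ofX_injective (e.injective ((hσ a).trans (h ▸ (hσ b).symm)))
  have hτi : Function.Injective τ := fun a b h =>
    Mops.ofY_injective (e.injective ((hτ a).trans (h ▸ (hτ b).symm)))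
  have hσs : Function.Surjective σ := fun w => by
    obtain ⟨v, hv⟩ := Mops.isJoinIrred_iff.1
      ((isJoinIrred_map_iff e.symm).2 (Mops.isJoinIrred_iff.2 ⟨w, rfl⟩))
    exact ⟨v, Mops.ofX_injective ((hσ v).symm.trans (by rw [← hv]; simp))⟩
  have hnear : ∀ a b, H.Near (σ a) (τ b) ↔ G.Near a b := fun a b => by
    rw [← not_iff_not, ← Mops.ofX_le_ofY, ← Mops.ofX_le_ofY, ← hσ, ← hτ, e.le_iff_le]
  let f := Equiv.ofBijective σ ⟨hσi, hσs⟩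
  -- Reflexivity of `Near` at `v` shows that `τ v` lies weakly below `σ v`, so `τ ∘ σ⁻¹` moves no
  -- vertex upward.
  have hστ : ∀ v, τ v = σ v := fun v => by
    have := eq_id_of_geq (H := H) (π := τ ∘ f.symm) (hτi.comp f.symm.injective) (fun w => by
      have := ((hnear (f.symm w) (f.symm w)).2 (Near.refl _)).geq
      rwa [show σ (f.symm w) = w from f.apply_symm_apply w] at this) (σ v)
    rwa [Function.comp_apply, show f.symm (σ v) = v from f.symm_apply_apply v] at this
  refine ⟨⟨f, fun {a b} => ?_⟩⟩
  show H.Adj (σ a) (σ b) ↔ G.Adj a b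
  have h3 := hnear a b
  rw [hστ] at h3
  by_cases hab : a = b
  · subst hab
    exact ⟨fun h => absurd h (irrefl _), fun h => absurd h (irrefl _)⟩
  · have : σ a ≠ σ b := fun h => hab (hσi h)
    simpa [Near, hab, this] using h3

theorem isIsoTo_of_tops_mops [Finite V] [Finite W] (e : G.Tops ≃o H.Mops) : G.IsIsoTo H := by
  obtain ⟨e'⟩ := Tops.nonempty_orderIso (IsLatticeOrder.of_orderIso e (Mops.isLatticeOrder H))
  exact isIsoTo_of_mops (e'.symm.trans e)

end AcyclicDigraph

/-! ### Labellings of a lattice by a left modular chain -/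

/-- Elements `j a`, `m a` and left modular elements `q a` of a lattice, indexed by `V`: the `j a`
are join-dense, the `m a` are meet-dense, and the `q a` form a chain that is compatible with
them. -/
structure ChainLabelling (L : Type w) [Lattice L] (V : Type u) where
  j : V → L
  m : V → L
  q : V → L
  q_inj : Function.Injective q
  q_total : ∀ a b, q a ≤ q b ∨ q b ≤ q a
  q_mod : ∀ a, IsLeftModularElt (q a)
  sup_dense : ∀ z z', (∀ a, j a ≤ z → j a ≤ z') → z ≤ z'
  inf_dense : ∀ z z', (∀ a, z' ≤ m a → z ≤ m a) → z ≤ z'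
  j_le_m : ∀ a b, q a < q b → j a ≤ m b
  not_j_le_m : ∀ a, ¬ j a ≤ m a
  q_le_m : ∀ b c, q b ≤ m c → q b < q c
  j_le_q : ∀ a b, j a ≤ q b → q a ≤ q b

namespace ChainLabelling

open AcyclicDigraph

variable {L : Type w} [Lattice L] {V : Type u} (S : ChainLabelling L V)

theorem lt_of_not_j_le_m {a b : V} (hab : a ≠ b) (h : ¬ S.j a ≤ S.m b) : S.q b < S.q a := by
  have h1 : ¬ S.q a < S.q b := fun h' => h (S.j_le_m a b h')
  rcases S.q_total a b with h' | h'
  · exact absurd (lt_of_le_of_ne h' fun e => hab (S.q_inj e)) h1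
  · exact lt_of_le_of_ne h' fun e => hab (S.q_inj e.symm)

/-- The Galois graph of a labelling. -/
def graph : AcyclicDigraph V where
  Adj a b := a ≠ b ∧ ¬ S.j a ≤ S.m b
  acyclic v h := by
    have : ∀ b, Relation.TransGen (fun a b => a ≠ b ∧ ¬ S.j a ≤ S.m b) v b → S.q b < S.q v := by
      intro b hb
      induction hb with
      | single h => exact S.lt_of_not_j_le_m h.1 h.2
      | tail _ h ih => exact (S.lt_of_not_j_le_m h.1 h.2).trans ih
    exact lt_irrefl _ (this v h)

theorem near_iff {a b : V} : S.graph.Near a b ↔ ¬ S.j a ≤ S.m b := by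
  constructor
  · rintro (rfl | h)
    · exact S.not_j_le_m a
    · exact h.2
  · intro h
    by_cases hab : a = b
    · exact Or.inl hab
    · exact Or.inr ⟨hab, h⟩

/-- If `K` dominates the labels of the meet irreducible elements above `y`, then it detects the
join irreducible elements that are not below `y`. -/
theorem exists_not_j_le_m [Finite L] {y : L} {K : Set V} (hK : ∀ u ∈ K, y ≤ S.m u)
    (hKd : ∀ b, y ≤ S.m b → ∃ u ∈ K, ¬ S.j b ≤ S.m u) {k : V} (hk : ¬ S.j k ≤ y) :
    ∃ u ∈ K, ¬ S.j k ≤ S.m u := by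
  have hex : ∃ b, y ≤ S.m b ∧ ¬ S.j k ≤ S.m b := by
    by_contra! h
    exact hk (S.inf_dense _ _ h)
  -- Among the `m b` separating `j k` from `y`, take the one latest along the chain. It then
  -- suffices that `j b ≤ y ⊔ j k`, since `K` detects `j b`.
  obtain ⟨b, ⟨hyb, hkb⟩, hmax⟩ := exists_maximalFor_of_wellFoundedGT _ S.q hex
  have hjb : S.j b ≤ y ⊔ S.j k := by
    by_contra hjb
    -- Left modularity of `q b` turns the upper bound `y ⊔ q b` for `j k`, due to maximality of `b`,
    -- into `y ⊔ q b ⊓ (y ⊔ j k)`. If `j b` is not below `y ⊔ j k`, the latter is below `m b`, a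
    -- contradiction.
    have hmod := S.q_mod b y (y ⊔ S.j k) le_sup_left
    have h1 : S.j k ≤ y ⊔ S.q b := by
      refine S.inf_dense _ _ fun c hc => ?_
      by_contra hkc
      have hlt := S.q_le_m b c (le_sup_right.trans hc)
      exact (hmax ⟨le_sup_left.trans hc, hkc⟩ hlt.le).not_gt hlt
    have h2 : S.q b ⊓ (y ⊔ S.j k) ≤ S.m b := by
      refine S.sup_dense _ _ fun e he => ?_
      have hne : e ≠ b := by
        rintro rfl
        exact hjb (he.trans inf_le_right)
      exact S.j_le_m e b (lt_of_le_of_ne (S.j_le_q e b (he.trans inf_le_left))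
        fun h => hne (S.q_inj h))
    have h3 : S.j k ≤ y ⊔ S.q b ⊓ (y ⊔ S.j k) := hmod ▸ le_inf h1 le_sup_right
    exact hkb (h3.trans (sup_le hyb h2))
  obtain ⟨u, hu, hbu⟩ := hKd b hyb
  exact ⟨u, hu, fun h => hbu (hjb.trans (sup_le (hK u hu) h))⟩

/-- The maximal orthogonal pair of an element. -/
def toMop (z : L) : S.graph.Mops :=
  Mops.mk' {a | S.j a ≤ z} {b | z ≤ S.m b}
    (by
      ext a
      constructor
      · exact fun ha b hb hab => S.near_iff.1 hab (le_trans (b := z) ha hb)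
      · intro h
        refine S.inf_dense _ _ fun b hb => ?_
        by_contra hn
        exact h b hb (S.near_iff.2 hn))
    (by
      ext b
      constructor
      · exact fun hb a ha hab => S.near_iff.1 hab (le_trans (b := z) ha hb)
      · intro h
        refine S.sup_dense _ _ fun a ha => ?_
        by_contra hn
        exact h a ha (S.near_iff.2 hn))

theorem toMop_surjective [Finite L] [Nonempty L] : Function.Surjective S.toMop := by
  intro p
  classical
  cases nonempty_fintype L
  let _ : BoundedOrder L := Fintype.toBoundedOrder L
  obtain ⟨z, hz⟩ : ∃ z : L, IsLUB {z | ∃ a ∈ p.X, z = S.j a} z := by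
    have hfin : ({z | ∃ a ∈ p.X, z = S.j a} : Set L).Finite := Set.toFinite _
    exact ⟨hfin.toFinset.sup id, by simpa using hfin.toFinset.isLUB_sup_id⟩
  have hX : p.X ⊆ (S.toMop z).X := fun a ha => hz.1 ⟨a, ha, rfl⟩
  have hY : p.Y ⊆ (S.toMop z).Y := fun b hb => hz.2 (by
    rintro _ ⟨a, ha, rfl⟩
    by_contra hn
    exact isOrth_iff.1 p.orth a ha b hb (S.near_iff.2 hn))
  exact ⟨z, le_antisymm (Mops.le_iff_Y.2 hY : S.toMop z ≤ p) (hX : p ≤ S.toMop z)⟩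

/-- The lattice is the lattice of maximal orthogonal pairs of the Galois graph. -/
theorem nonempty_orderIso_mops [Finite L] [Nonempty L] : Nonempty (L ≃o S.graph.Mops) :=
  ⟨RelIso.ofSurjective (OrderEmbedding.ofMapLEIff S.toMop fun _ _ =>
    ⟨fun h => S.sup_dense _ _ h, fun h _ ha => le_trans ha h⟩) S.toMop_surjective⟩

/-- This is the form of `exists_not_j_le_m` in the graph: a dominating subset of `p.Y` has the same
polar as `p.Y`. -/
theorem lperp_subset_X [Finite L] [Nonempty L] (p : S.graph.Mops) {K : Set V} (hK : K ⊆ p.Y)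
    (hKd : ∀ b ∈ p.Y, ∃ u ∈ K, S.graph.Near b u) : S.graph.lperp K ⊆ p.X := by
  obtain ⟨y, rfl⟩ := S.toMop_surjective p
  intro k hk
  by_contra hkX
  obtain ⟨u, hu, hku⟩ := S.exists_not_j_le_m (y := y) (K := K) (fun u hu => hK hu)
    (fun b hb => by
      obtain ⟨u, hu, h⟩ := hKd b hb
      exact ⟨u, hu, S.near_iff.1 h⟩) (k := k) hkX
  exact hk u hu (S.near_iff.2 hku)

theorem good [Finite L] [Nonempty L] (t : S.graph.Tops) : t.Good := by
  refine S.lperp_subset_X (Mops.ofX t.D) t.U_subset fun b hb => ?_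
  rcases t.cover b with h | h | ⟨d, hd, h⟩ | ⟨u, hu, h⟩
  · exact absurd (Near.refl b) (hb b h)
  · exact ⟨b, h, Near.refl b⟩
  · exact absurd (Or.inr h) (hb d hd)
  · exact ⟨u, hu, Or.inr h⟩

theorem nonempty_orderIso_tops [Finite V] [Finite L] [Nonempty L] :
    Nonempty (L ≃o S.graph.Tops) := by
  obtain ⟨e⟩ := S.nonempty_orderIso_mops
  suffices h : Function.Surjective (Tops.toMops S.good) from
    ⟨e.trans (RelIso.ofSurjective (Tops.toMops S.good) h).symm⟩
  intro p
  -- The kernel for reversed edges is an independent dominating subset of `p.Y`, so it can serve as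
  -- the `U` of a preimage.
  obtain ⟨K, hK⟩ := S.graph.op.exists_kernel p.Y
  have hKY : K ⊆ p.Y := fun k hk => ((hK k).1 hk).1
  obtain ⟨t, ht⟩ := exists_top_U (G := S.graph) (U := K) fun a ha b hb h => ((hK a).1 ha).2 b hb h
  refine ⟨t, le_antisymm (α := S.graph.Mops) ?_ ?_⟩
  · show S.graph.lperp t.U ⊆ p.X
    rw [ht]
    refine S.lperp_subset_X p hKY fun b hb => ?_
    by_cases hbK : b ∈ K
    · exact ⟨b, hbK, Near.refl b⟩
    · by_contra! hn
      exact hbK ((hK b).2 ⟨hb, fun d hd h => hn d hd (Or.inr h)⟩)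
  · show p.X ⊆ S.graph.lperp t.U
    rw [ht, p.X_eq]
    exact lperp_anti hKY

end ChainLabelling

/-! ### Trim lattices have a labelling -/

section Trim

variable {L : Type w} [Lattice L]

theorem IsChain.exists_least [Finite L] {c : Set L} (hc : IsChain (· ≤ ·) c) {P : L → Prop}
    (hP : ∀ x y, P x → x ≤ y → P y) (hex : ∃ x ∈ c, P x) :
    ∃ x ∈ c, ∀ y ∈ c, P y ↔ x ≤ y := by
  obtain ⟨x, ⟨hxc, hx⟩, hmin⟩ := exists_minimal_of_wellFoundedLT (fun x => x ∈ c ∧ P x) hex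
  refine ⟨x, hxc, fun y hy => ⟨fun h => ?_, fun h => hP x y hx h⟩⟩
  rcases hc.total hxc hy with h' | h'
  · exact h'
  · exact hmin ⟨hy, h⟩ h'

theorem IsChain.exists_pred [Finite L] {c : Set L} (hc : IsChain (· ≤ ·) c) {x : L}
    (hex : ∃ y ∈ c, y < x) : ∃ p ∈ c, p < x ∧ ∀ y ∈ c, y < x → y ≤ p := by
  obtain ⟨p, ⟨hpc, hp⟩, hmax⟩ := exists_maximal_of_wellFoundedGT (fun y => y ∈ c ∧ y < x) hex
  refine ⟨p, hpc, hp, fun y hy h => ?_⟩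
  rcases hc.total hpc hy with h' | h'
  · exact hmax ⟨hy, h⟩ h'
  · exact h'

theorem IsMaxChain.mem_of_comparable {c : Set L} (hc : IsMaxChain (· ≤ ·) c) {w : L}
    (h : ∀ y ∈ c, w ≤ y ∨ y ≤ w) : w ∈ c := by
  have := hc.2 (hc.1.insert fun y hy _ => h y hy) (Set.subset_insert w c)
  rw [this]
  exact Set.mem_insert _ _

theorem IsMaxChain.mem_of_between {c : Set L} (hc : IsMaxChain (· ≤ ·) c) {p x w : L}
    (hx : x ∈ c) (hp : ∀ y ∈ c, y < x → y ≤ p) (hpw : p ≤ w) (hwx : w ≤ x) : w ∈ c :=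
  hc.mem_of_comparable fun y hy => by
    by_cases h : y < x
    · exact Or.inr ((hp y hy h).trans hpw)
    · rcases hc.1.total hx hy with h' | h'
      · exact Or.inl (hwx.trans h')
      · exact Or.inl (hwx.trans (eq_of_le_of_not_lt h' h).ge)

/-- No chain is longer than a left modular maximal chain. -/
theorem IsMaxChain.length_le [Finite L] [BoundedOrder L] {c : Set L} (hc : IsMaxChain (· ≤ ·) c)
    (hmod : ∀ x ∈ c, IsLeftModularElt x) (y : LTSeries L) :
    y.length ≤ Nat.card {x : L // x ∈ c ∧ x ≠ ⊥} := by
  -- Each step of the chain `y` is assigned the first element of `c` that detects it by meets; this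
  -- assignment turns out to be injective.
  have hex : ∀ k : Fin y.length, ∃ x ∈ c, ∀ x' ∈ c, ¬ x' ⊓ y k.succ ≤ y k.castSucc ↔ x ≤ x' := by
    intro k
    refine hc.1.exists_least (P := fun x' => ¬ x' ⊓ y k.succ ≤ y k.castSucc)
      (fun x x' hx hle h => hx ((inf_le_inf_right _ hle).trans h)) ⟨⊤, hc.top_mem, ?_⟩
    rw [top_inf_eq]
    exact (y.step k).not_ge
  choose x hxc hx using hex
  have hx0 : ∀ k, x k ≠ ⊥ := fun k h => (hx k _ (hxc k)).2 le_rfl (by rw [h, bot_inf_eq]; exact bot_le)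
  have hne : ∀ k l, k < l → x k ≠ x l := by
    intro k l hkl he
    obtain ⟨p, hpc, hpx, hp⟩ := hc.1.exists_pred ⟨⊥, hc.bot_mem, bot_lt_iff_ne_bot.2 (hx0 k)⟩
    have hpk : p ⊓ y k.succ ≤ y k.castSucc := by
      by_contra h
      exact hpx.not_ge ((hx k p hpc).1 h)
    have hpl : p ⊓ y l.succ ≤ y l.castSucc := by
      by_contra h
      exact hpx.not_ge (he ▸ (hx l p hpc).1 h)
    have hkl' : y k.succ ≤ y l.castSucc := y.monotone (by
      rw [Fin.le_def, Fin.val_succ, Fin.val_castSucc]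
      exact hkl)
    have hw : p ⊔ x k ⊓ y k.succ ∈ c :=
      hc.mem_of_between (hxc k) hp le_sup_left (sup_le hpx.le inf_le_left)
    have hxk : ¬ x k ⊓ y k.succ ≤ y k.castSucc := (hx k _ (hxc k)).2 le_rfl
    have hxl : ¬ x l ⊓ y l.succ ≤ y l.castSucc := (hx l _ (hxc l)).2 le_rfl
    by_cases hwx : p ⊔ x k ⊓ y k.succ < x k
    · exact hxk ((le_inf (le_sup_right.trans (hp _ hw hwx)) inf_le_right).trans hpk)
    · have hle : x k ≤ p ⊔ x k ⊓ y k.succ :=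
        (eq_of_le_of_not_lt (sup_le hpx.le inf_le_left) hwx).ge
      -- Two steps `k < l` share the element `x l`, with predecessor `p`. As the earlier step
      -- already gives `x l ≤ y l.castSucc ⊔ p`, left modularity of `p` makes the later step
      -- invisible to `x l`.
      have hle' : x l ≤ y l.castSucc ⊔ p :=
        he ▸ hle.trans (sup_le le_sup_right (inf_le_right.trans (hkl'.trans le_sup_left)))
      have hm := hmod p hpc (y l.castSucc) (y l.succ) (y.step l).le
      rw [sup_eq_left.2 hpl] at hm
      exact hxl (hm ▸ inf_le_inf_right _ hle')
  have hinj : Function.Injective fun k => (⟨x k, hxc k, hx0 k⟩ : {x : L // x ∈ c ∧ x ≠ ⊥}) := by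
    intro k l h
    have h' : x k = x l := congrArg Subtype.val h
    rcases lt_trichotomy k l with hl | he | hl
    · exact absurd h' (hne k l hl)
    · exact he
    · exact absurd h'.symm (hne l k hl)
  simpa using Nat.card_le_card_of_injective _ hinj

/-- Labels are the nonbottom elements of the left modular chain. A join irreducible is labelled by
the first chain element above it, a meet irreducible by the first one not below it. Every step of
the chain is separated by irreducibles of both kinds, so both maps are surjective; extremality and
`IsMaxChain.length_le` make them bijective by counting. -/
theorem IsTrimLattice.exists_labelling [Finite L] [BoundedOrder L] (h : IsTrimLattice L) :
    ∃ (V : Type u) (_ : Finite V), Nonempty (ChainLabelling L V) := by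
  obtain ⟨⟨hJ, hM⟩, c, hc, hmod⟩ := h
  let V₀ := {x : L // x ∈ c ∧ x ≠ ⊥}
  obtain ⟨y, hy⟩ := Order.le_krullDim_iff.1 hJ.ge
  have hcardJ : Nat.card {x : L // SupIrred x} ≤ Nat.card V₀ := hy ▸ hc.length_le hmod y
  have hcardM : Nat.card {x : L // InfIrred x} ≤ Nat.card V₀ := by
    have : (Nat.card {x : L // InfIrred x} : WithBot ℕ∞) = Nat.card {x : L // SupIrred x} :=
      hM.symm.trans hJ
    have : Nat.card {x : L // InfIrred x} = Nat.card {x : L // SupIrred x} := by exact_mod_cast this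
    exact this ▸ hcardJ
  have hf : ∀ i : {x : L // SupIrred x}, ∃ x : V₀, ∀ x' ∈ c, i.1 ≤ x' ↔ x.1 ≤ x' := by
    intro i
    obtain ⟨x, hx, h⟩ := hc.1.exists_least (P := fun x' => i.1 ≤ x')
      (fun _ _ => le_trans) ⟨⊤, hc.top_mem, le_top⟩
    refine ⟨⟨x, hx, fun h0 => i.2.ne_bot (le_bot_iff.1 ?_)⟩, h⟩
    exact h0 ▸ (h x hx).2 le_rfl
  have hg : ∀ i : {x : L // InfIrred x}, ∃ x : V₀, ∀ x' ∈ c, ¬ x' ≤ i.1 ↔ x.1 ≤ x' := by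
    intro i
    obtain ⟨x, hx, h⟩ := hc.1.exists_least (P := fun x' => ¬ x' ≤ i.1)
      (fun _ _ h1 h2 h3 => h1 (h2.trans h3))
      ⟨⊤, hc.top_mem, fun h => i.2.ne_top (top_le_iff.1 h)⟩
    refine ⟨⟨x, hx, fun h0 => (h x hx).2 le_rfl ?_⟩, h⟩
    rw [h0]
    exact bot_le
  choose f hf using hf
  choose g hg using hg
  have hpred : ∀ x : V₀, ∃ p ∈ c, p < x.1 ∧ ∀ y ∈ c, y < x.1 → y ≤ p := fun x =>
    hc.1.exists_pred ⟨⊥, hc.bot_mem, bot_lt_iff_ne_bot.2 x.2.2⟩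
  have supd : ∀ z z' : L, (∀ i, SupIrred i → i ≤ z → i ≤ z') → z ≤ z' := by
    intro z z' h
    obtain ⟨s, rfl, hs⟩ := exists_supIrred_decomposition z
    exact Finset.sup_le fun i hi => h i (hs hi) (Finset.le_sup (f := id) hi)
  have infd : ∀ z z' : L, (∀ i, InfIrred i → z' ≤ i → z ≤ i) → z ≤ z' := by
    intro z z' h
    obtain ⟨s, rfl, hs⟩ := exists_infIrred_decomposition z'
    exact Finset.le_inf fun i hi => h i (hs hi) (Finset.inf_le (f := id) hi)
  have hfs : Function.Surjective f := by
    intro x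
    obtain ⟨p, hpc, hpx, hp⟩ := hpred x
    have : ∃ i, SupIrred i ∧ i ≤ x.1 ∧ ¬ i ≤ p := by
      by_contra! hn
      exact hpx.not_ge (supd _ _ hn)
    obtain ⟨i, hi, hix, hip⟩ := this
    refine ⟨⟨i, hi⟩, Subtype.ext ?_⟩
    refine eq_of_le_of_not_lt ((hf ⟨i, hi⟩ x.1 x.2.1).1 hix) fun hlt => hip ?_
    exact (hf ⟨i, hi⟩ p hpc).2 (hp _ (f ⟨i, hi⟩).2.1 hlt)
  have hgs : Function.Surjective g := by
    intro x
    obtain ⟨p, hpc, hpx, hp⟩ := hpred x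
    have : ∃ i, InfIrred i ∧ p ≤ i ∧ ¬ x.1 ≤ i := by
      by_contra! hn
      exact hpx.not_ge (infd _ _ hn)
    obtain ⟨i, hi, hpi, hxi⟩ := this
    refine ⟨⟨i, hi⟩, Subtype.ext ?_⟩
    refine eq_of_le_of_not_lt ((hg ⟨i, hi⟩ x.1 x.2.1).1 hxi) fun hlt => ?_
    exact (hg ⟨i, hi⟩ _ (g ⟨i, hi⟩).2.1).2 le_rfl ((hp _ (g ⟨i, hi⟩).2.1 hlt).trans hpi)
  let F := Equiv.ofBijective f (hfs.bijective_of_nat_card_le hcardJ)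
  let E := Equiv.ofBijective g (hgs.bijective_of_nat_card_le hcardM)
  -- Reindexing puts the vertex set in the required universe.
  let ε : ULift.{u} (Fin (Nat.card V₀)) ≃ V₀ := Equiv.ulift.trans (Finite.equivFin V₀).symm
  have hj : ∀ a : V₀, ∀ x ∈ c, (F.symm a).1 ≤ x ↔ a.1 ≤ x := fun a x hx => by
    rw [hf _ x hx, show f (F.symm a) = a from F.apply_symm_apply a]
  have hm : ∀ a : V₀, ∀ x ∈ c, ¬ x ≤ (E.symm a).1 ↔ a.1 ≤ x := fun a x hx => by
    rw [hg _ x hx, show g (E.symm a) = a from E.apply_symm_apply a]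
  have hm' : ∀ a : V₀, ∀ x ∈ c, x < a.1 → x ≤ (E.symm a).1 := fun a x hx hlt => by
    by_contra hn
    exact hlt.not_ge ((hm a x hx).1 hn)
  refine ⟨ULift.{u} (Fin (Nat.card V₀)), inferInstance, ⟨{
    j := fun a => (F.symm (ε a)).1
    m := fun a => (E.symm (ε a)).1
    q := fun a => (ε a).1
    q_inj := fun a b h => ε.injective (Subtype.ext h)
    q_total := fun a b => hc.1.total (ε a).2.1 (ε b).2.1
    q_mod := fun a => hmod _ (ε a).2.1
    sup_dense := fun z z' h => supd z z' fun i hi hiz => ?_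
    inf_dense := fun z z' h => infd z z' fun i hi hiz => ?_
    j_le_m := fun a b hlt => ((hj (ε a) _ (ε a).2.1).2 le_rfl).trans (hm' (ε b) _ (ε a).2.1 hlt)
    not_j_le_m := fun a ha => ?_
    q_le_m := fun b e hbe => ?_
    j_le_q := fun a b h => (hj (ε a) _ (ε b).2.1).1 h }⟩⟩
  · have := h (ε.symm (F ⟨i, hi⟩))
    simp only [Equiv.apply_symm_apply, Equiv.symm_apply_apply] at this
    exact this hiz
  · have := h (ε.symm (E ⟨i, hi⟩))
    simp only [Equiv.apply_symm_apply, Equiv.symm_apply_apply] at this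
    exact this hiz
  -- The join of the predecessor `p` with the join irreducible labelled `a` is the chain element
  -- itself. Both joinands would lie below the meet irreducible labelled `a`, but the chain element
  -- does not.
  · obtain ⟨p, hpc, hpx, hp⟩ := hpred (ε a)
    have hpm := hm' (ε a) p hpc hpx
    have hw := hc.mem_of_between (ε a).2.1 hp (w := p ⊔ (F.symm (ε a)).1) le_sup_left
      (sup_le hpx.le ((hj (ε a) _ (ε a).2.1).2 le_rfl))
    have hle := (hj (ε a) _ hw).1 le_sup_right
    exact (hm (ε a) _ (ε a).2.1).2 le_rfl (hle.trans (sup_le hpm ha))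
  · have hn : ¬ (ε e).1 ≤ (ε b).1 := fun hle => (hm (ε e) _ (ε b).2.1).2 hle hbe
    exact lt_of_le_not_ge ((hc.1.total (ε b).2.1 (ε e).2.1).resolve_right hn) hn

end Trim

theorem IsExtremalLattice.nonempty {L : Type*} [Lattice L] (h : IsExtremalLattice L) :
    Nonempty L := by
  by_contra hn
  rw [not_nonempty_iff] at hn
  have := h.1
  rw [Order.krullDim_eq_bot] at this
  exact absurd this (by simp)

theorem isLatticeOrder_of_lattice (L : Type*) [Lattice L] : IsLatticeOrder L :=
  fun _ _ => ⟨⟨_, isLUB_pair⟩, ⟨_, isGLB_pair⟩⟩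

theorem mainTheorem6 :
    -- if `top(G) ≃ L(H)` then `G ≃ H`
    (∀ (V : Type u) (W : Type v) [Finite V] [Finite W]
      (G : AcyclicDigraph V) (H : AcyclicDigraph W),
      Nonempty (G.Tops ≃o H.Mops) → G.IsIsoTo H) ∧
    -- if `top(G)` is a lattice then `top(G) ≃ L(G)`
    (∀ (V : Type u) [Finite V] (G : AcyclicDigraph V),
      IsLatticeOrder G.Tops → Nonempty (G.Tops ≃o G.Mops)) ∧
    -- every finite trim lattice is `top(G)` for a unique `G` (up to isomorphism)
    (∀ (L : Type w) [Lattice L] [Finite L], IsTrimLattice L →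
      ∃ (V : Type u) (_ : Finite V) (G : AcyclicDigraph V),
        Nonempty (L ≃o G.Tops) ∧
        ∀ (W : Type v) [Finite W] (H : AcyclicDigraph W),
          Nonempty (L ≃o H.Tops) → G.IsIsoTo H) := by
  refine ⟨fun V W _ _ G H ⟨e⟩ => AcyclicDigraph.isIsoTo_of_tops_mops e,
    fun V _ G hL => AcyclicDigraph.Tops.nonempty_orderIso hL, fun L _ _ hL => ?_⟩
  have := hL.1.nonempty
  cases nonempty_fintype L
  let _ : BoundedOrder L := Fintype.toBoundedOrder L
  obtain ⟨V, hV, ⟨S⟩⟩ := hL.exists_labelling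
  obtain ⟨e⟩ := S.nonempty_orderIso_tops
  refine ⟨V, hV, S.graph, ⟨e⟩, fun W _ H ⟨e'⟩ => ?_⟩
  -- Since `L` is a lattice, so is `H.Tops`, which may therefore be replaced by `H.Mops`.
  obtain ⟨i⟩ := AcyclicDigraph.Tops.nonempty_orderIso
    (AcyclicDigraph.IsLatticeOrder.of_orderIso e'.symm (isLatticeOrder_of_lattice L))
  exact AcyclicDigraph.isIsoTo_of_tops_mops ((e.symm.trans e').trans i)
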